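/- Let $A$ be a finite connected graph (loops and parallel edges allowed), and let $G$ and $H$ be two embeddings of $A$ on the sphere. The medial graph $G^\times$ of a plane graph $G$ is the 4-regular plane graph with one vertex on each edge of $G$ and with one edge, joining the vertices on $e$ and $e'$, for each pair of edge ends of $e$, $e'$ that are consecutive in the cyclic order around a vertex of $G$; if $G$ is a single vertex, $G^\times$ is a simple closed curve. Call $G$ unicursal if $G^\times$ is the image of a single closed curve $\gamma$ that goes straight ahead (to the opposite edge) at each vertex. For a closed curve $\gamma$ on the sphere with finitely many transverse double points (its vertices), with a chosen basepoint and orientation, let $\operatorname{sgn}(x)=+1$ if the first traversal through the vertex $x$ crosses the second from right to left and $\operatorname{sgn}(x)=-1$ otherwise, and put \[ \mathit{defect}(\gamma) = -2\sum_{\{x,y\}} \operatorname{sgn}(x)\operatorname{sgn}(y), \] the sum being over all unordered pairs of vertices that are interleaved, i.e. met in the cyclic order $x,y,x,y$ along $\gamma$. If $G$ is unicursal, then $H$ is unicursal and $\mathit{defect}(G^\times)=\mathit{defect}(H^\times)$, for every choice of basepoints and orientations of the two curves. -/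

import Mathlib

noncomputable section

/-- A multigraph is connected if it has a vertex and any two vertices are joined by a walk. -/
def Graph.IsConnected {V E : Type*} (G : Graph V E) : Prop :=
  G.vertexSet.Nonempty ∧
    ∀ x ∈ G.vertexSet, ∀ y ∈ G.vertexSet, Relation.ReflTransGen G.Adj x y

/-- A combinatorial map on an oriented surface, given on its set `D` of darts (half-edges).
`rot d` is the dart that follows `d` in counterclockwise order around the vertex of `d`;
`flip d` is the other half of the edge of `d`. -/
structure CombMap (D : Type*) where
  rot : Equiv.Perm D
  flip : Equiv.Perm D
  flip_flip : ∀ d, flip (flip d) = d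
  flip_ne : ∀ d, flip d ≠ d

namespace CombMap

variable {D : Type*}

/-- The vertices of a map are the cycles of `rot`. -/
def Vertex (M : CombMap D) : Type _ :=
  Quotient (Equiv.Perm.SameCycle.setoid M.rot)

/-- The vertex at which a dart is based. -/
def vert (M : CombMap D) (d : D) : M.Vertex :=
  Quotient.mk (Equiv.Perm.SameCycle.setoid M.rot) d

/-- The permutation that walks along the boundaries of the faces: go along `d` and, at its far end,
take the next edge in the rotation. -/
def faceStep (M : CombMap D) : Equiv.Perm D := M.rot * M.flip

/-- The faces of a map are the cycles of `faceStep`. -/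
def Face (M : CombMap D) : Type _ :=
  Quotient (Equiv.Perm.SameCycle.setoid M.faceStep)

open Classical in
/-- The number of faces. A map without darts is a single vertex on the sphere, with one face. -/
def numFaces (M : CombMap D) : ℕ :=
  if IsEmpty D then 1 else Nat.card M.Face

/-- The medial map. Its darts are `(d, true)` and `(d, false)` for the darts `d` of `M`, all based at
the medial vertex in the middle of the edge of `d`: the half-edge `(d, true)` leads into the corner
of `M` between `d` and `rot d`, and `(d, false)` leads into the corner between `rot⁻¹ d` and `d`.
So each corner `(d, rot d)` of `M` carries the medial edge with halves `(d, true)` and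
`(rot d, false)`, and the counterclockwise order around the middle of the edge of `d` is
`(d, true), (d, false), (flip d, true), (flip d, false)`. -/
def medial (M : CombMap D) : CombMap (D × Bool) where
  rot :=
    { toFun := fun
        | (d, true) => (d, false)
        | (d, false) => (M.flip d, true)
      invFun := fun
        | (d, true) => (M.flip d, false)
        | (d, false) => (d, true)
      left_inv := by rintro ⟨d, _ | _⟩ <;> simp [M.flip_flip]
      right_inv := by rintro ⟨d, _ | _⟩ <;> simp [M.flip_flip] }
  flip :=
    { toFun := fun
        | (d, true) => (M.rot d, false)
        | (d, false) => (M.rot.symm d, true)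
      invFun := fun
        | (d, true) => (M.rot d, false)
        | (d, false) => (M.rot.symm d, true)
      left_inv := by rintro ⟨d, _ | _⟩ <;> simp
      right_inv := by rintro ⟨d, _ | _⟩ <;> simp }
  flip_flip := by rintro ⟨d, _ | _⟩ <;> simp
  flip_ne := by rintro ⟨d, _ | _⟩ <;> simp

/-! The curves of a 4-regular map `M`. A closed curve is followed through its outgoing darts: leave a
vertex along `d`, reach the next vertex through `flip d`, and leave it along the opposite dart. -/

/-- One step straight ahead in a 4-regular map, from an outgoing dart to the next one. -/
def straight (M : CombMap D) : Equiv.Perm D := M.rot * M.rot * M.flip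

/-- The 4-regular map `M` is the image of a single closed curve: following a dart straight ahead, one
traverses every edge, in one of its two directions. The map without darts (the medial map of a
single vertex) counts as a simple closed curve. -/
def IsSingleCurve (M : CombMap D) : Prop :=
  ∀ b d : D, M.straight.SameCycle b d ∨ M.straight.SameCycle b (M.flip d)

/-- The `i`-th outgoing dart of the curve that starts with outgoing dart `b`. The choice of `b` is the
choice of an orientation and of a basepoint (just before the vertex of `b`). -/
def curve (M : CombMap D) (b : D) (i : ℕ) : D := M.straight^[i] b

/-- The times, within one period of the curve from `b`, at which it passes through `x`. -/
def visits (M : CombMap D) (b : D) (x : M.Vertex) : Set ℕ :=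
  {i | i < Function.minimalPeriod M.straight b ∧ M.vert (M.curve b i) = x}

/-- The time of the first traversal through `x`. -/
def firstVisit (M : CombMap D) (b : D) (x : M.Vertex) : ℕ := sInf (M.visits b x)

/-- The time of the second (and last) traversal through `x`. -/
def secondVisit (M : CombMap D) (b : D) (x : M.Vertex) : ℕ := sSup (M.visits b x)

open Classical in
/-- The sign of a vertex: `+1` if the first traversal crosses the second one from right to left, that
is, if it leaves along the dart that follows the outgoing dart of the second traversal in
counterclockwise order; `-1` otherwise. -/
def sgn (M : CombMap D) (b : D) (x : M.Vertex) : ℤ :=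
  if M.curve b (M.firstVisit b x) = M.rot (M.curve b (M.secondVisit b x)) then 1 else -1

/-- The vertices `x` and `y` are interleaved, and `x` is met first: the traversals come in the
order `x`, `y`, `x`, `y`. -/
def Interleaved (M : CombMap D) (b : D) (x y : M.Vertex) : Prop :=
  M.firstVisit b x < M.firstVisit b y ∧ M.firstVisit b y < M.secondVisit b x ∧
    M.secondVisit b x < M.secondVisit b y

/-- The defect `-2 ∑ sgn x * sgn y` of the curve with starting dart `b`, the sum being over the
interleaved pairs of vertices; each unordered pair occurs once, with `x` the vertex met first. -/
def defect (M : CombMap D) (b : D) : ℤ :=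
  -2 * ∑ᶠ (p : M.Vertex × M.Vertex) (_ : M.Interleaved b p.1 p.2), M.sgn b p.1 * M.sgn b p.2

end CombMap

/-- Swapping the two ends of every edge. -/
def swapEnds (E : Type*) : Equiv.Perm (E × Bool) where
  toFun d := (d.1, !d.2)
  invFun d := (d.1, !d.2)
  left_inv := by rintro ⟨e, _ | _⟩ <;> rfl
  right_inv := by rintro ⟨e, _ | _⟩ <;> rfl

/-- An embedding of a connected multigraph `G` (loops and parallel edges allowed) on the sphere, up
to orientation-preserving homeomorphism. The two ends of each edge `e` are named `(e, false)` and
`(e, true)`, and `base` tells at which vertex each end lies; `rot` is the counterclockwise order of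
the edge ends around the vertices. By Euler's formula the surface is the sphere. -/
structure PlanarEmbedding {V E : Type*} (G : Graph V E) where
  base : G.edgeSet × Bool → V
  isLink : ∀ e : G.edgeSet, G.IsLink e (base (e, false)) (base (e, true))
  rot : Equiv.Perm (G.edgeSet × Bool)
  sameCycle_iff : ∀ d d', rot.SameCycle d d' ↔ base d = base d'
  euler : G.vertexSet.ncard +
      CombMap.numFaces ⟨rot, swapEnds G.edgeSet, by simp [swapEnds], by simp [swapEnds]⟩ =
    G.edgeSet.ncard + 2

namespace PlanarEmbedding

variable {V E : Type*} {G : Graph V E}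

/-- The combinatorial map of an embedding. -/
def toMap (P : PlanarEmbedding G) : CombMap (G.edgeSet × Bool) :=
  ⟨P.rot, swapEnds G.edgeSet, by simp [swapEnds], by simp [swapEnds]⟩

/-- The medial graph of the plane graph `P`, a 4-regular map. -/
def medial (P : PlanarEmbedding G) : CombMap ((G.edgeSet × Bool) × Bool) :=
  P.toMap.medial

/-- A plane graph is unicursal if its medial graph is the image of a single closed curve. -/
def Unicursal (P : PlanarEmbedding G) : Prop := P.medial.IsSingleCurve

end PlanarEmbedding

end

/-!
Resolve the crossings of the medial curve one at a time, in the three possible ways at each: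
keep the crossing, or smooth it along the edge or across it. With `weight` the number of
self-crossings of a curve minus twice its defect, the quantity
`(-2) ^ #curves * (2 * #curves + #crossings + 3 * total weight)` satisfies the same linear
relation under resolution as `(-2) ^ #curves`: the state with the crossing is minus the sum of
the two smoothed ones. The relation uses that any two closed curves on the sphere have algebraic
intersection number zero. Hence both quantities of the medial curve are sums over the complete
smoothings, that is, over the sets `S` of edges that are kept, of functions of the number of
loops alone. By Euler's formula that number is `2 c(S) + |S| - |V|`, where `c(S)` is the number
of components of the spanning subgraph with edge set `S`, so it does not depend on the
embedding. The first quantity determines the number of closed curves of the medial graph and the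
second one then determines the defect.
-/

section OrderedSums

variable {α β M : Type*}

section AddCommMonoid

variable [AddCommMonoid M]

/-- The sum of `g` over the pairs of entries of a list, in the order of the list. -/
def pairSum (g : α → α → M) : List α → M
  | [] => 0
  | a :: w => (w.map (g a)).sum + pairSum g w

/-- The sum of `g` over the triples of entries of a list, in the order of the list. -/
def tripleSum (g : α → α → α → M) : List α → M
  | [] => 0
  | a :: w => pairSum (g a) w + tripleSum g w

/-- The sum of `g` over the quadruples of entries of a list, in the order of the list. -/
def quadSum (g : α → α → α → α → M) : List α → M
  | [] => 0
  | a :: w => tripleSum (g a) w + quadSum g w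

theorem pairSum_congr {g h : α → α → M} {w : List α} (H : w.Pairwise fun a b => g a b = h a b) :
    pairSum g w = pairSum h w := by
  induction H with
  | nil => rfl
  | cons ha _ ih => rw [pairSum, pairSum, ih, List.map_congr_left ha]

theorem tripleSum_congr {g h : α → α → α → M} {w : List α}
    (H : ∀ a ∈ w, ∀ b ∈ w, ∀ c ∈ w, g a b c = h a b c) : tripleSum g w = tripleSum h w := by
  induction w with
  | nil => rfl
  | cons a w ih =>
    simp only [List.forall_mem_cons] at H
    rw [tripleSum, tripleSum, ih fun b hb c hc => ((H.2 b hb).2 c hc).2,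
      pairSum_congr (List.pairwise_of_forall_mem_list (H.1.2 · · |>.2))]

theorem quadSum_congr {g h : α → α → α → α → M} {w : List α}
    (H : ∀ a ∈ w, ∀ b ∈ w, ∀ c ∈ w, ∀ d ∈ w, g a b c d = h a b c d) :
    quadSum g w = quadSum h w := by
  induction w with
  | nil => rfl
  | cons a w ih =>
    simp only [List.forall_mem_cons] at H
    rw [quadSum, quadSum, ih fun b hb c hc d hd => (((H.2 b hb).2 c hc).2 d hd).2,
      tripleSum_congr fun b hb c hc d hd => ((H.1.2 b hb).2 c hc).2 d hd]

@[simp] theorem pairSum_zero (w : List α) : pairSum (fun _ _ => (0 : M)) w = 0 := by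
  induction w with
  | nil => rfl
  | cons a w ih => simp [pairSum, ih]

@[simp] theorem tripleSum_zero (w : List α) : tripleSum (fun _ _ _ => (0 : M)) w = 0 := by
  induction w with
  | nil => rfl
  | cons a w ih => simp [tripleSum, ih]

theorem pairSum_eq_zero {g : α → α → M} {w : List α} (H : w.Pairwise fun a b => g a b = 0) :
    pairSum g w = 0 := by
  rw [pairSum_congr H, pairSum_zero]

theorem pairSum_add (g h : α → α → M) (w : List α) :
    pairSum (fun a b => g a b + h a b) w = pairSum g w + pairSum h w := by
  induction w with
  | nil => simp [pairSum]
  | cons a w ih => simp only [pairSum, ih, List.sum_map_add]; abel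

theorem tripleSum_add (g h : α → α → α → M) (w : List α) :
    tripleSum (fun a b c => g a b c + h a b c) w = tripleSum g w + tripleSum h w := by
  induction w with
  | nil => simp [tripleSum]
  | cons a w ih => simp only [tripleSum, ih, pairSum_add]; abel

theorem pairSum_append (g : α → α → M) (u v : List α) :
    pairSum g (u ++ v) =
      pairSum g u + (u.map fun a => (v.map (g a)).sum).sum + pairSum g v := by
  induction u with
  | nil => simp [pairSum]
  | cons a u ih =>
    simp only [List.cons_append, pairSum, ih, List.map_append, List.sum_append, List.map_cons,
      List.sum_cons]
    abel

theorem tripleSum_append (g : α → α → α → M) (u v : List α) :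
    tripleSum g (u ++ v) =
      tripleSum g u + pairSum (fun a b => (v.map (g a b)).sum) u +
        (u.map fun a => pairSum (g a) v).sum + tripleSum g v := by
  induction u with
  | nil => simp [pairSum, tripleSum]
  | cons a u ih =>
    simp only [List.cons_append, pairSum, tripleSum, ih, pairSum_append, List.map_cons,
      List.sum_cons]
    abel

theorem quadSum_append (g : α → α → α → α → M) (u v : List α) :
    quadSum g (u ++ v) =
      quadSum g u + tripleSum (fun a b c => (v.map (g a b c)).sum) u +
        pairSum (fun a b => pairSum (g a b) v) u +
          (u.map fun a => tripleSum (g a) v).sum + quadSum g v := by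
  induction u with
  | nil => simp [pairSum, tripleSum, quadSum]
  | cons a u ih =>
    simp only [List.cons_append, pairSum, tripleSum, quadSum, ih, tripleSum_append, List.map_cons,
      List.sum_cons]
    abel

theorem pairSum_reverse (g : α → α → M) (w : List α) :
    pairSum g w.reverse = pairSum (fun a b => g b a) w := by
  induction w with
  | nil => rfl
  | cons a w ih => simp [pairSum_append, pairSum, ih, add_comm]

theorem tripleSum_reverse (g : α → α → α → M) (w : List α) :
    tripleSum g w.reverse = tripleSum (fun a b c => g c b a) w := by
  induction w with
  | nil => rfl
  | cons a w ih => simp [tripleSum_append, pairSum_reverse, pairSum, tripleSum, ih, add_comm]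

theorem quadSum_reverse (g : α → α → α → α → M) (w : List α) :
    quadSum g w.reverse = quadSum (fun a b c d => g d c b a) w := by
  induction w with
  | nil => rfl
  | cons a w ih =>
    simp [quadSum_append, tripleSum_reverse, pairSum, tripleSum, quadSum, ih, add_comm]

theorem pairSum_map (g : β → β → M) (φ : α → β) (w : List α) :
    pairSum g (w.map φ) = pairSum (fun a b => g (φ a) (φ b)) w := by
  induction w with
  | nil => rfl
  | cons a w ih => simp only [List.map_cons, pairSum, ih, List.map_map, Function.comp_def]

theorem tripleSum_map (g : β → β → β → M) (φ : α → β) (w : List α) :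
    tripleSum g (w.map φ) = tripleSum (fun a b c => g (φ a) (φ b) (φ c)) w := by
  induction w with
  | nil => rfl
  | cons a w ih => simp only [List.map_cons, tripleSum, ih, pairSum_map]

theorem quadSum_map (g : β → β → β → β → M) (φ : α → β) (w : List α) :
    quadSum g (w.map φ) = quadSum (fun a b c d => g (φ a) (φ b) (φ c) (φ d)) w := by
  induction w with
  | nil => rfl
  | cons a w ih => simp only [List.map_cons, quadSum, ih, tripleSum_map]

theorem sum_map_sum_map_comm (g : α → β → M) (u : List α) (v : List β) :
    (u.map fun a => (v.map (g a)).sum).sum = (v.map fun b => (u.map (g · b)).sum).sum := by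
  simpa using Multiset.sum_map_sum_map (u : Multiset α) (v : Multiset β) (f := g)

theorem sum_map_tripleSum (g : β → α → α → α → M) (u : List β) (v : List α) :
    (u.map fun i => tripleSum (g i) v).sum =
      tripleSum (fun a b c => (u.map (g · a b c)).sum) v := by
  induction u with
  | nil => simp
  | cons i u ih => simp only [List.map_cons, List.sum_cons, ih, tripleSum_add]

theorem pairSum_append_cons_of_null (g : α → α → M) {a : α} (h₁ : ∀ b, g a b = 0)
    (h₂ : ∀ b, g b a = 0) (u v : List α) : pairSum g (u ++ a :: v) = pairSum g (u ++ v) := by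
  simp [pairSum_append, pairSum, show g a = fun _ => 0 from funext h₁, h₂]

theorem tripleSum_append_cons_of_null (g : α → α → α → M) {a : α} (h₁ : ∀ b c, g a b c = 0)
    (h₂ : ∀ b c, g b a c = 0) (h₃ : ∀ b c, g b c a = 0) (u v : List α) :
    tripleSum g (u ++ a :: v) = tripleSum g (u ++ v) := by
  have ha : pairSum (g a) v = 0 := pairSum_eq_zero (List.pairwise_of_forall h₁)
  simp [tripleSum_append, tripleSum, pairSum, fun i => show g i a = fun _ => 0 from funext (h₂ i),
    h₃, ha]

theorem quadSum_append_cons_of_null (g : α → α → α → α → M) {a : α}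
    (h₁ : ∀ b c d, g a b c d = 0) (h₂ : ∀ b c d, g b a c d = 0) (h₃ : ∀ b c d, g b c a d = 0)
    (h₄ : ∀ b c d, g b c d a = 0) (u v : List α) :
    quadSum g (u ++ a :: v) = quadSum g (u ++ v) := by
  induction u with
  | nil =>
    have ha : tripleSum (g a) v = 0 := by
      rw [show g a = fun _ _ _ => 0 from funext₃ h₁, tripleSum_zero]
    simp [quadSum, ha]
  | cons b u ih =>
    simp only [List.cons_append, quadSum, ih,
      tripleSum_append_cons_of_null _ (h₂ b) (h₃ b) (h₄ b)]

end AddCommMonoid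

theorem sum_map_neg [AddCommGroup M] (g : α → M) (w : List α) :
    (w.map fun a => -g a).sum = -(w.map g).sum := by
  simpa using Multiset.sum_map_neg (m := (w : Multiset α)) (f := g)

theorem tripleSum_neg [AddCommGroup M] (g : α → α → α → M) (w : List α) :
    tripleSum (fun a b c => -g a b c) w = -tripleSum g w := by
  rw [eq_neg_iff_add_eq_zero, ← tripleSum_add]
  simp

variable {R : Type*} [CommRing R]

theorem sum_map_mul_sum_map (g h : α → R) (w : List α) :
    (w.map g).sum * (w.map h).sum =
      pairSum (fun a b => g a * h b) w + pairSum (fun a b => g b * h a) w +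
        (w.map fun a => g a * h a).sum := by
  induction w with
  | nil => simp [pairSum]
  | cons a w ih =>
    simp only [List.map_cons, List.sum_cons, pairSum, List.sum_map_mul_left,
      List.sum_map_mul_right]
    linear_combination ih

theorem tripleSum_eq_zero_of_between {e : α → α → R} {g : α → R} (w : List α)
    (H : ∀ w₁ i w₂ k w₃, w = w₁ ++ i :: w₂ ++ k :: w₃ → e i k ≠ 0 → (w₂.map g).sum = 0) :
    tripleSum (fun i j k => e i k * g j) w = 0 := by
  have sum_first (i : α) : ∀ w : List α,
      (∀ w₂ k w₃, w = w₂ ++ k :: w₃ → e i k ≠ 0 → (w₂.map g).sum = 0) →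
        pairSum (fun j k => e i k * g j) w = 0 := by
    intro w
    induction w using List.reverseRecOn with
    | nil => exact fun _ => rfl
    | append_singleton w k ih =>
      intro H
      have hk : e i k * (w.map g).sum = 0 := by
        by_cases h : e i k = 0
        · rw [h, zero_mul]
        · rw [H w k [] rfl h, mul_zero]
      rw [pairSum_append, ih fun w₂ k' w₃ h => H w₂ k' (w₃ ++ [k]) (by simp [h])]
      simp [pairSum, List.sum_map_mul_left, hk]
  induction w with
  | nil => rfl
  | cons i w ih =>
    rw [tripleSum, ih fun w₁ i' w₂ k w₃ h => H (i :: w₁) i' w₂ k w₃ (by simp [h]), add_zero]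
    exact sum_first i w fun w₂ k w₃ h => H [] i w₂ k w₃ (by simp [h])

theorem tripleSum_eq_zero_of_sides {c : α → R} {e : α → α → R} (w : List α)
    (H : ∀ w₁ k w₂, w = w₁ ++ k :: w₂ → c k ≠ 0 →
      (w₁.map fun j => (w₂.map (e j)).sum).sum = 0) :
    tripleSum (fun j k l => c k * e j l) w = 0 := by
  -- The induction on `w` needs the part `pre` of the list that has already been passed.
  suffices hsplit : ∀ w pre : List α,
      (∀ w₁ k w₂, w = w₁ ++ k :: w₂ → c k ≠ 0 →
        ((pre ++ w₁).map fun j => (w₂.map (e j)).sum).sum = 0) →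
      pairSum (fun k l => c k * (pre.map (e · l)).sum) w +
        tripleSum (fun j k l => c k * e j l) w = 0 by
    simpa using hsplit w [] (by simpa using H)
  intro w
  induction w with
  | nil => simp [pairSum, tripleSum]
  | cons b w ih =>
    intro pre H
    have hw := ih (pre ++ [b]) fun w₁ k w₂ h hk => by
      simpa using H (b :: w₁) k w₂ (by simp [h]) hk
    have hb : c b * (w.map fun l => (pre.map (e · l)).sum).sum = 0 := by
      rw [← sum_map_sum_map_comm]
      by_cases hb : c b = 0
      · rw [hb, zero_mul]
      · have hpre : (pre.map fun j => (w.map (e j)).sum).sum = 0 := by simpa using H [] b w rfl hb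
        rw [hpre, mul_zero]
    simp only [List.map_append, List.sum_append, List.map_cons, List.map_nil, List.sum_cons,
      List.sum_nil, mul_add, pairSum_add, add_zero] at hw
    simp only [pairSum, tripleSum, List.sum_map_mul_left] at hw ⊢
    linear_combination hw + hb

end OrderedSums

section RangeSums

variable {α M : Type*} [AddCommMonoid M]

theorem sum_map_range (g : α → M) (c : ℕ → α) (n : ℕ) :
    (((List.range n).map c).map g).sum = ∑ i ∈ Finset.range n, g (c i) := by
  rw [List.map_map]
  rfl

theorem pairSum_map_range (g : α → α → M) (c : ℕ → α) (n : ℕ) :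
    pairSum g ((List.range n).map c) =
      ∑ j ∈ Finset.range n, ∑ i ∈ Finset.range j, g (c i) (c j) := by
  induction n with
  | zero => rfl
  | succ n ih =>
    rw [List.range_succ, List.map_append, pairSum_append, ih, Finset.sum_range_succ,
      ← sum_map_range (g · (c n))]
    simp [pairSum]

theorem tripleSum_map_range (g : α → α → α → M) (c : ℕ → α) (n : ℕ) :
    tripleSum g ((List.range n).map c) = ∑ k ∈ Finset.range n, ∑ j ∈ Finset.range k,
      ∑ i ∈ Finset.range j, g (c i) (c j) (c k) := by
  induction n with
  | zero => rfl
  | succ n ih =>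
    rw [List.range_succ, List.map_append, tripleSum_append, ih, Finset.sum_range_succ,
      ← pairSum_map_range (g · · (c n))]
    simp [pairSum, tripleSum, Function.comp_def]

theorem quadSum_map_range (g : α → α → α → α → M) (c : ℕ → α) (n : ℕ) :
    quadSum g ((List.range n).map c) = ∑ l ∈ Finset.range n, ∑ k ∈ Finset.range l,
      ∑ j ∈ Finset.range k, ∑ i ∈ Finset.range j, g (c i) (c j) (c k) (c l) := by
  induction n with
  | zero => rfl
  | succ n ih =>
    rw [List.range_succ, List.map_append, quadSum_append, ih, Finset.sum_range_succ,
      ← tripleSum_map_range (g · · · (c n))]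
    simp [pairSum, tripleSum, quadSum, Function.comp_def]

end RangeSums

section Weight

variable {α R : Type*} [CommRing R]

/-- The sum of `E i k * E j l` over the positions `i < j < k < l` of a list. When `E` is the
antisymmetric form that records the signs of the crossings along a closed curve, this is the sum
over the interleaved pairs in the definition of the defect. -/
def interleavedSum (E : α → α → R) (w : List α) : R := quadSum (fun i j k l => E i k * E j l) w

/-- The quantity that satisfies a linear relation when a crossing of a closed curve with list of
passages `w` is resolved: the interleaved sum, corrected by the number of crossings. -/
def weight (E : α → α → R) (w : List α) : R :=
  pairSum (fun a b => E a b ^ 2) w + 4 * interleavedSum E w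

/-- The sum of a form over the pairs with one entry in each of two lists: the intersection number
of two curves. -/
def crossSum (E : α → α → R) (u v : List α) : R := (u.map fun a => (v.map (E a)).sum).sum

variable {E : α → α → R}

theorem crossSum_cons_left (E : α → α → R) (a : α) (u v : List α) :
    crossSum E (a :: u) v = (v.map (E a)).sum + crossSum E u v := rfl

theorem crossSum_cons_right (E : α → α → R) (a : α) (u v : List α) :
    crossSum E u (a :: v) = (u.map (E · a)).sum + crossSum E u v := by
  simp only [crossSum, List.map_cons, List.sum_cons, List.sum_map_add]

theorem crossSum_congr {E' : α → α → R} {u v : List α} (h : ∀ a ∈ u, ∀ b ∈ v, E a b = E' a b) :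
    crossSum E u v = crossSum E' u v :=
  congrArg _ (List.map_congr_left fun a ha => congrArg _ (List.map_congr_left (h a ha)))

theorem interleavedSum_congr {E' : α → α → R} {w : List α}
    (h : ∀ a ∈ w, ∀ b ∈ w, E a b = E' a b) : interleavedSum E w = interleavedSum E' w :=
  quadSum_congr fun a ha b hb c hc d hd => by rw [h a ha c hc, h b hb d hd]

theorem weight_congr {E' : α → α → R} {w : List α} (h : ∀ a ∈ w, ∀ b ∈ w, E a b = E' a b) :
    weight E w = weight E' w := by
  rw [weight, weight, interleavedSum_congr h,
    pairSum_congr (List.pairwise_of_forall_mem_list fun a ha b hb => by rw [h a ha b hb])]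

theorem weight_append_cons_of_null (hE : ∀ a b, E b a = -E a b) {a : α} (ha : ∀ b, E a b = 0)
    (u v : List α) : weight E (u ++ a :: v) = weight E (u ++ v) := by
  have ha' (b : α) : E b a = 0 := by rw [hE, ha, neg_zero]
  rw [weight, weight, interleavedSum, interleavedSum,
    quadSum_append_cons_of_null _ (by simp [ha]) (by simp [ha]) (by simp [ha']) (by simp [ha']),
    pairSum_append_cons_of_null _ (by simp [ha]) (by simp [ha'])]

theorem weight_cons_of_null (hE : ∀ a b, E b a = -E a b) {a : α} (ha : ∀ b, E a b = 0)
    (w : List α) : weight E (a :: w) = weight E w :=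
  weight_append_cons_of_null hE ha [] w

theorem interleavedSum_cons (a : α) (w : List α)
    (H : ∀ w₁ k w₂, w = w₁ ++ k :: w₂ → E a k ≠ 0 → crossSum E w₁ w₂ = 0) :
    interleavedSum E (a :: w) = interleavedSum E w := by
  rw [interleavedSum, quadSum, tripleSum_eq_zero_of_sides w H, zero_add, interleavedSum]

theorem interleavedSum_concat (hE : ∀ a b, E b a = -E a b) (a : α) (w : List α)
    (H : ∀ w₁ k w₂, w = w₁ ++ k :: w₂ → E a k ≠ 0 → crossSum E w₁ w₂ = 0) :
    interleavedSum E (w ++ [a]) = interleavedSum E w := by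
  have hlast : tripleSum (fun i j k => E i k * E j a) w = 0 := by
    rw [← neg_eq_zero, ← tripleSum_neg, ← tripleSum_eq_zero_of_sides w H]
    congr! 4 with i j k
    rw [hE a j]; ring
  simp [interleavedSum, quadSum_append, quadSum, tripleSum, pairSum, hlast]

theorem weight_rotate_one (hE : ∀ a b, E b a = -E a b) (a : α) (w : List α)
    (H : ∀ w₁ k w₂, w = w₁ ++ k :: w₂ → E a k ≠ 0 → crossSum E w₁ w₂ = 0) :
    weight E (w ++ [a]) = weight E (a :: w) := by
  rw [weight, weight, interleavedSum_cons a w H, interleavedSum_concat hE a w H, pairSum_append]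
  simp [pairSum, hE a, add_comm]

theorem interleavedSum_append {u v : List α}
    (huv : tripleSum (fun i j k => E i k * (v.map (E j)).sum) u = 0)
    (hvu : tripleSum (fun j k l => (u.map (E · k)).sum * E j l) v = 0) :
    interleavedSum E (u ++ v) = interleavedSum E u +
      pairSum (fun i j => pairSum (fun k l => E i k * E j l) v) u + interleavedSum E v := by
  simp only [interleavedSum, quadSum_append, sum_map_tripleSum, List.sum_map_mul_left,
    List.sum_map_mul_right, huv, hvu, add_zero]

section Reversal

variable {ν : α → α}

theorem interleavedSum_reverse_map (hE : ∀ a b, E b a = -E a b) (hν : ∀ a b, E (ν a) b = -E a b)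
    (w : List α) : interleavedSum E (w.map ν).reverse = interleavedSum E w := by
  have hνν (a b : α) : E (ν a) (ν b) = E a b := by rw [hν, ← hE, hν, ← hE]
  simp only [interleavedSum, quadSum_reverse, quadSum_map, hνν]
  congr! 5 with a b c d
  rw [hE b d, hE a c]; ring

theorem pairSum_sq_append (E : α → α → R) (u v : List α) :
    pairSum (fun a b => E a b ^ 2) (u ++ v) = pairSum (fun a b => E a b ^ 2) u +
      crossSum (fun a b => E a b ^ 2) u v + pairSum (fun a b => E a b ^ 2) v :=
  pairSum_append _ u v

theorem pairSum_sq_append_reverse_map (hE : ∀ a b, E b a = -E a b)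
    (hν : ∀ a b, E (ν a) b = -E a b) (u v : List α) :
    pairSum (fun a b => E a b ^ 2) (u ++ (v.map ν).reverse) =
      pairSum (fun a b => E a b ^ 2) (u ++ v) := by
  have hν' (a b : α) : E a (ν b) ^ 2 = E a b ^ 2 := by rw [hE, neg_sq, hν, neg_sq, hE, neg_sq]
  have hν₂ (a b : α) : E (ν a) b ^ 2 = E a b ^ 2 := by rw [hν, neg_sq]
  simp only [pairSum_append, pairSum_reverse, pairSum_map, List.map_reverse, List.sum_reverse,
    List.map_map, Function.comp_def, hν₂, hν']
  congr! 4 with a b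
  rw [hE, neg_sq]

end Reversal

theorem sq_crossSum {u v : List α}
    (hv : v.Pairwise fun a b => ∀ c ∈ u, E c a * E c b = 0) :
    crossSum E u v ^ 2 = 2 * pairSum (fun i j => (v.map (E i)).sum * (v.map (E j)).sum) u +
      crossSum (fun a b => E a b ^ 2) u v := by
  have row_sq : ∀ i ∈ u, (v.map (E i)).sum * (v.map (E i)).sum = (v.map (E i · ^ 2)).sum := by
    intro i hi
    rw [sum_map_mul_sum_map, pairSum_eq_zero (hv.imp fun h => h i hi),
      pairSum_eq_zero (hv.imp fun h => by rw [mul_comm]; exact h i hi)]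
    simp only [sq, zero_add]
  have swap : pairSum (fun i j => (v.map (E j)).sum * (v.map (E i)).sum) u =
      pairSum (fun i j => (v.map (E i)).sum * (v.map (E j)).sum) u := by
    congr! 3 with i j
    exact mul_comm _ _
  rw [sq, crossSum, sum_map_mul_sum_map, List.map_congr_left row_sq, swap, crossSum, two_mul]

theorem pairSum_pairSum_add_swap {u v : List α}
    (hu : u.Pairwise fun a b => ∀ c ∈ v, E a c * E b c = 0) :
    pairSum (fun i j => pairSum (fun k l => E i k * E j l) v) u +
      pairSum (fun i j => pairSum (fun k l => E i l * E j k) v) u =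
        pairSum (fun i j => (v.map (E i)).sum * (v.map (E j)).sum) u := by
  rw [← pairSum_add]
  refine pairSum_congr (hu.imp fun {i j} h => ?_)
  rw [sum_map_mul_sum_map, List.map_congr_left h, List.sum_map_zero, add_zero]

/-- Two strands `u` and `v` of a closed curve can be joined in two ways, one of which reverses
`v`. -/
theorem weight_append_add_weight_append_reverse (hE : ∀ a b, E b a = -E a b) {ν : α → α}
    (hν : ∀ a b, E (ν a) b = -E a b) {u v : List α}
    (hu : u.Pairwise fun a b => ∀ c ∈ v, E a c * E b c = 0)
    (hv : v.Pairwise fun a b => ∀ c ∈ u, E c a * E c b = 0)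
    (huv : tripleSum (fun i j k => E i k * (v.map (E j)).sum) u = 0)
    (hvu : tripleSum (fun i j k => E i k * (u.map (E j)).sum) v = 0) :
    weight E (u ++ v) + weight E (u ++ (v.map ν).reverse) =
      2 * (weight E u + weight E v) + 2 * crossSum E u v ^ 2 := by
  have hEν (a b : α) : E a (ν b) = -E a b := by rw [hE, hν, hE b a]
  have hvu' : tripleSum (fun j k l => (u.map (E · k)).sum * E j l) v = 0 := by
    rw [← neg_eq_zero, ← tripleSum_neg, ← hvu]
    congr! 4 with j k l
    rw [← neg_mul, mul_comm, ← sum_map_neg]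
    congr! 4
    exact (hE _ _).symm
  have huw : tripleSum (fun i j k => E i k * ((v.map ν).reverse.map (E j)).sum) u = 0 := by
    rw [← neg_eq_zero, ← tripleSum_neg, ← huv]
    congr! 4 with i j k
    simp only [List.map_reverse, List.sum_reverse, List.map_map, Function.comp_def, hEν,
      sum_map_neg]
    ring
  have hwu : tripleSum (fun j k l => (u.map (E · k)).sum * E j l) (v.map ν).reverse = 0 := by
    rw [tripleSum_reverse, tripleSum_map, ← hvu']
    congr! 4 with j k l
    rw [hν, hEν, hE j l, neg_neg, List.map_congr_left fun i _ => hEν i k, sum_map_neg]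
    ring
  have hrev : pairSum (fun i j => pairSum (fun k l => E i k * E j l) (v.map ν).reverse) u =
      pairSum (fun i j => pairSum (fun k l => E i l * E j k) v) u := by
    simp only [pairSum_reverse, pairSum_map, hEν, neg_mul_neg]
  rw [weight, weight, interleavedSum_append huv hvu', interleavedSum_append huw hwu, hrev,
    interleavedSum_reverse_map hE hν, pairSum_sq_append_reverse_map hE hν, pairSum_sq_append,
    weight, weight, sq_crossSum hv]
  linear_combination 4 * pairSum_pairSum_add_swap hu

end Weight

section Walks

variable {α : Type*} {f m m' : α → α}

/-- Given the map `f` that exchanges the two halves of each edge, and the map `m` that joins the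
half-edges at each vertex in pairs, `IsWalk f m p w z` says that a curve that starts along the
half-edge `p` leaves the next vertices along the half-edges in `w` and then arrives at a vertex
through the half-edge `z`. -/
def IsWalk (f m : α → α) : α → List α → α → Prop
  | p, [], z => f p = z
  | p, b :: w, z => b = m (f p) ∧ IsWalk f m b w z

/-- A nonempty cyclic list of half-edges along which a closed curve leaves the vertices that it
visits. -/
def IsClosedWalk (f m : α → α) : List α → Prop
  | [] => False
  | p :: w => ∃ z, IsWalk f m p w z ∧ p = m z

/-- A list that contains exactly one half of each edge. -/
def IsHalf (f : α → α) (l : List α) : Prop :=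
  (l ++ l.map f).Nodup ∧ ∀ d, d ∈ l ++ l.map f

/-- A list of all the closed curves, each with a direction and a starting point. -/
structure IsTrace (f m : α → α) (D : List (List α)) : Prop where
  closed : ∀ w ∈ D, IsClosedWalk f m w
  half : IsHalf f D.flatten

theorem isWalk_append {p q z : α} {u v : List α} :
    IsWalk f m p (u ++ q :: v) z ↔ ∃ y, IsWalk f m p u y ∧ q = m y ∧ IsWalk f m q v z := by
  induction u generalizing p with
  | nil => simp [IsWalk]
  | cons b u ih => simp [IsWalk, ih, and_assoc]

namespace IsWalk

theorem reverse (hf : f.Involutive) (hm : m.Involutive) {p z : α} {w : List α}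
    (h : IsWalk f m p w z) : IsWalk f m z (w.map m).reverse p := by
  induction w generalizing p with
  | nil => rw [← show f p = z from h]; exact hf p
  | cons b w ih =>
    obtain ⟨hb, h⟩ := h
    rw [List.map_cons, List.reverse_cons]
    exact isWalk_append.2 ⟨b, ih h, rfl, by simp [IsWalk, hb, hf _, hm _]⟩

theorem reverse_perm (hm : m.Involutive) {p z : α} {w : List α} (h : IsWalk f m p w z) :
    (z :: (w.map m).reverse).Perm ((p :: w).map f) := by
  refine ((List.reverse_perm _).cons z).trans ?_
  induction w generalizing p with
  | nil => rw [← show f p = z from h]; simp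
  | cons b w ih =>
    obtain ⟨hb, h⟩ := h
    rw [List.map_cons, List.map_cons, show m b = f p by rw [hb, hm]]
    exact (List.Perm.swap _ _ _).trans ((ih h).cons _)

theorem congr (hm : m.Involutive) (hm' : m'.Involutive) {p z : α} {w : List α}
    (h : IsWalk f m p w z) (hw : ∀ b ∈ w, m b = m' b) : IsWalk f m' p w z := by
  induction w generalizing p with
  | nil => exact h
  | cons b w ih =>
    obtain ⟨hb, h⟩ := h
    refine ⟨?_, ih h fun b hb => hw b (.tail _ hb)⟩
    rw [← hm'.eq_iff, ← hw b (.head _), hb, hm]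

theorem map_comp {p z : α} {w : List α} (h : IsWalk f m p w z) :
    (p :: w).map (m ∘ f) = w ++ [m z] := by
  induction w generalizing p with
  | nil => rw [← show f p = z from h]; rfl
  | cons b w ih =>
    obtain ⟨rfl, h⟩ := h
    rw [List.map_cons, ih h]
    rfl

end IsWalk

namespace IsClosedWalk

variable {w : List α}

theorem congr (hm : m.Involutive) (hm' : m'.Involutive) (h : IsClosedWalk f m w)
    (hw : ∀ b ∈ w, m b = m' b) : IsClosedWalk f m' w := by
  cases w with
  | nil => exact h
  | cons p w =>
    obtain ⟨z, h, hz⟩ := h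
    refine ⟨z, h.congr hm hm' fun b hb => hw b (.tail _ hb), ?_⟩
    rw [← hm'.eq_iff, ← hw p (.head _), hz, hm]

theorem rotate {u v : List α} (h : IsClosedWalk f m (u ++ v)) : IsClosedWalk f m (v ++ u) := by
  cases u with
  | nil => simpa using h
  | cons p u =>
    cases v with
    | nil => simpa using h
    | cons q v =>
      obtain ⟨z, h, hz⟩ := h
      obtain ⟨y, h₁, h₂, h₃⟩ := isWalk_append.1 h
      exact ⟨y, isWalk_append.2 ⟨z, h₃, hz, h₁⟩, h₂⟩

theorem map_comp_perm (h : IsClosedWalk f m w) : (w.map (m ∘ f)).Perm w := by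
  cases w with
  | nil => rfl
  | cons p w =>
    obtain ⟨z, hwalk, rfl⟩ := h
    rw [hwalk.map_comp]
    exact List.perm_append_singleton _ _

theorem exists_pred (h : IsClosedWalk f m w) {d : α} (hd : d ∈ w) : ∃ a ∈ w, m (f a) = d :=
  List.mem_map.1 (h.map_comp_perm.mem_iff.2 hd)

theorem succ_mem (h : IsClosedWalk f m w) {d : α} (hd : d ∈ w) : m (f d) ∈ w :=
  h.map_comp_perm.mem_iff.1 (List.mem_map_of_mem hd)

theorem count_left [BEq α] [LawfulBEq α] (hf : f.Involutive) (hm : m.Involutive)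
    (h : IsClosedWalk f m w) (a : α) : w.count (f a) = w.count (m a) := by
  rw [← List.count_map_of_injective w _ (hm.injective.comp hf.injective), Function.comp_apply, hf,
    h.map_comp_perm.count_eq]

theorem left_mem_iff (hf : f.Involutive) (hm : m.Involutive) (h : IsClosedWalk f m w) {a : α} :
    f a ∈ w ↔ m a ∈ w := by
  classical
  rw [← List.count_pos_iff, h.count_left hf hm, List.count_pos_iff]

end IsClosedWalk

namespace IsHalf

variable {l l' : List α}

theorem nodup (h : IsHalf f l) : l.Nodup := h.1.of_append_left

theorem mem_or (hf : f.Involutive) (h : IsHalf f l) (d : α) : d ∈ l ∨ f d ∈ l := by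
  simpa [List.mem_map, hf.eq_iff] using h.2 d

theorem notMem (h : IsHalf f l) {d : α} (hd : d ∈ l) : f d ∉ l := fun hfd =>
  List.disjoint_of_nodup_append h.1 hfd (List.mem_map_of_mem hd)

theorem perm (h : IsHalf f l) (hl : l.Perm l') : IsHalf f l' :=
  have hperm := hl.append (hl.map f)
  ⟨hperm.nodup h.1, fun d => hperm.mem_iff.1 (h.2 d)⟩

theorem append_map_append (hf : f.Involutive) {u v w : List α} (h : IsHalf f (u ++ v ++ w)) :
    IsHalf f (u ++ v.map f ++ w) := by
  have hperm : (u ++ v ++ w ++ (u ++ v ++ w).map f).Perm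
      (u ++ v.map f ++ w ++ (u ++ v.map f ++ w).map f) := by
    simp only [List.map_append, List.map_map, hf.comp_self, List.map_id, ← Multiset.coe_eq_coe,
      ← Multiset.coe_add]
    abel
  exact ⟨hperm.nodup h.1, fun d => hperm.mem_iff.1 (h.2 d)⟩

end IsHalf

namespace IsTrace

variable {D D' : List (List α)}

theorem perm (h : IsTrace f m D) (hD : D.Perm D') : IsTrace f m D' :=
  ⟨fun w hw => h.closed w (hD.mem_iff.2 hw), h.half.perm hD.flatten⟩

theorem rotate {u v : List α} (h : IsTrace f m ((u ++ v) :: D)) :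
    IsTrace f m ((v ++ u) :: D) := by
  obtain ⟨hclosed, hhalf⟩ := h
  rw [List.forall_mem_cons] at hclosed
  exact ⟨List.forall_mem_cons.2 ⟨hclosed.1.rotate, hclosed.2⟩,
    hhalf.perm (List.perm_append_comm.append_right _)⟩

theorem apply_notMem (hm : m.Involutive) (h : IsTrace f m D) {d : α} (hd : d ∈ D.flatten) :
    m d ∉ D.flatten := by
  obtain ⟨w, hw, hdw⟩ := List.mem_flatten.1 hd
  obtain ⟨a, ha, rfl⟩ := (h.closed w hw).exists_pred hdw
  rw [hm]
  exact h.half.notMem (List.mem_flatten.2 ⟨w, hw, ha⟩)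

theorem mem_or_apply_mem (hf : f.Involutive) (h : IsTrace f m D) (d : α) :
    d ∈ D.flatten ∨ m d ∈ D.flatten := by
  refine (h.half.mem_or hf d).imp_right fun hd => ?_
  obtain ⟨w, hw, hdw⟩ := List.mem_flatten.1 hd
  have hsucc := (h.closed w hw).succ_mem hdw
  rw [hf] at hsucc
  exact List.mem_flatten.2 ⟨w, hw, hsucc⟩

end IsTrace

end Walks

section States

variable {X : Type*}

/-- The darts of the medial map of a map with edge set `X` and darts `X × Bool`. The darts
`((e, true), true)`, `((e, true), false)`, `((e, false), true)`, `((e, false), false)` surround the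
medial vertex on `e` in this cyclic order. -/
abbrev MedialDart (X : Type*) := (X × Bool) × Bool

/-- The three ways to join the four darts at a medial vertex in pairs: `none` is the crossing of two
curves that go straight ahead, `some true` is the smoothing that avoids the edge of the vertex, and
`some false` is the smoothing that cuts it. -/
def mateOf (τ : Option Bool) (d : MedialDart X) : MedialDart X :=
  match τ with
  | none => ((d.1.1, !d.1.2), d.2)
  | some false => (d.1, !d.2)
  | some true => ((d.1.1, !d.1.2), !d.2)

/-- The dart that is joined to a dart at its vertex in the state `σ`, which chooses one of the three
matchings at every medial vertex. -/
def mate (σ : X → Option Bool) (d : MedialDart X) : MedialDart X := mateOf (σ d.1.1) d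

theorem mateOf_involutive (τ : Option Bool) :
    Function.Involutive (mateOf τ : MedialDart X → MedialDart X) := by
  rintro ⟨⟨e, s⟩, t⟩
  rcases τ with _ | _ | _ <;> simp [mateOf]

@[simp] theorem mateOf_mateOf (τ : Option Bool) (d : MedialDart X) :
    mateOf τ (mateOf τ d) = d := mateOf_involutive τ d

theorem mateOf_ne (τ : Option Bool) (d : MedialDart X) : mateOf τ d ≠ d := by
  rcases d with ⟨⟨e, s⟩, t⟩
  rcases τ with _ | _ | _ <;> simp [mateOf]

@[simp] theorem mateOf_fst_fst (τ : Option Bool) (d : MedialDart X) :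
    (mateOf τ d).1.1 = d.1.1 := by
  rcases τ with _ | _ | _ <;> rfl

@[simp] theorem mate_fst_fst (σ : X → Option Bool) (d : MedialDart X) :
    (mate σ d).1.1 = d.1.1 := mateOf_fst_fst _ _

theorem mate_involutive (σ : X → Option Bool) : Function.Involutive (mate σ) := fun d => by
  simp [mate]

@[simp] theorem mate_mate (σ : X → Option Bool) (d : MedialDart X) : mate σ (mate σ d) = d :=
  mate_involutive σ d

theorem mate_ne (σ : X → Option Bool) (d : MedialDart X) : mate σ d ≠ d := mateOf_ne _ _

theorem mate_congr {σ σ' : X → Option Bool} {d : MedialDart X} (h : σ d.1.1 = σ' d.1.1) :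
    mate σ d = mate σ' d := by rw [mate, mate, h]

theorem exists_mateOf_eq {a b : MedialDart X} (h : a.1.1 = b.1.1) (hne : b ≠ a) :
    ∃ τ, b = mateOf τ a := by
  rcases a with ⟨⟨e, s⟩, t⟩
  rcases b with ⟨⟨e', s'⟩, t'⟩
  obtain rfl : e = e' := h
  by_cases hs : s = s' <;> by_cases ht : t = t'
  · simp [hs, ht] at hne
  · exact ⟨some false, by simp [mateOf, hs, Bool.eq_not.2 (Ne.symm ht)]⟩
  · exact ⟨none, by simp [mateOf, ht, Bool.eq_not.2 (Ne.symm hs)]⟩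
  · exact ⟨some true, by simp [mateOf, Bool.eq_not.2 (Ne.symm ht), Bool.eq_not.2 (Ne.symm hs)]⟩

theorem mateOf_left_injective (a : MedialDart X) :
    Function.Injective fun τ : Option Bool => mateOf τ a := by
  rcases a with ⟨⟨e, s⟩, t⟩
  intro τ τ' h
  rcases τ with _ | _ | _ <;> rcases τ' with _ | _ | _ <;> first | rfl | simp [mateOf] at h

theorem mateOf_comm (τ τ' : Option Bool) (a : MedialDart X) :
    mateOf τ (mateOf τ' a) = mateOf τ' (mateOf τ a) := by
  rcases τ with _ | _ | _ <;> rcases τ' with _ | _ | _ <;> simp [mateOf]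

/-- The three matchings and the identity form a Klein four-group. -/
theorem exists_mateOf_mateOf_eq {τ τ' : Option Bool} (h : τ ≠ τ') :
    ∃ τ'' : Option Bool, τ'' ≠ τ ∧ τ'' ≠ τ' ∧
      ∀ a : MedialDart X, mateOf τ'' (mateOf τ a) = mateOf τ' a := by
  rcases τ with _ | _ | _ <;> rcases τ' with _ | _ | _ <;> first
    | exact absurd rfl h
    | (refine ⟨none, ?_⟩; simp [mateOf]; done)
    | (refine ⟨some true, ?_⟩; simp [mateOf]; done)
    | (refine ⟨some false, ?_⟩; simp [mateOf])

theorem exists_matchings_of_ne {τ : Option Bool} {p q : MedialDart X} (hpq : p.1.1 = q.1.1)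
    (hne : q ≠ p) (hτ : q ≠ mateOf τ p) :
    ∃ τ' τ'', τ ≠ τ' ∧ τ ≠ τ'' ∧ τ' ≠ τ'' ∧ q = mateOf τ'' p ∧
      ∀ a : MedialDart X, mateOf τ' (mateOf τ a) = mateOf τ'' a := by
  obtain ⟨τ'', hq⟩ := exists_mateOf_eq hpq hne
  have hne : τ ≠ τ'' := by rintro rfl; exact hτ hq
  obtain ⟨τ', h₁, h₂, h⟩ := exists_mateOf_mateOf_eq (X := X) hne
  exact ⟨τ', τ'', h₁.symm, hne, h₂, hq, h⟩

theorem eq_or_eq_mateOf_of_ne (τ : Option Bool) {p q d : MedialDart X} (hpq : p.1.1 = q.1.1)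
    (hd : d.1.1 = p.1.1) (h₁ : q ≠ p) (h₂ : q ≠ mateOf τ p) :
    d = p ∨ d = mateOf τ p ∨ d = q ∨ d = mateOf τ q := by
  rcases p with ⟨⟨e, s⟩, t⟩
  rcases q with ⟨⟨e', s'⟩, t'⟩
  rcases d with ⟨⟨e'', s''⟩, t''⟩
  obtain rfl : e = e' := hpq
  obtain rfl : e'' = e := hd
  rcases τ with _ | _ | _ <;> cases s <;> cases t <;> cases s' <;> cases t' <;> cases s'' <;>
    cases t'' <;> simp_all [mateOf]

/-- Two strands `p :: u` and `q :: v` of the curves of the state `σ` between visits of the vertex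
`x`, which arrive at `x` through `y` and `z`, together with the list `D` of the other curves. -/
structure IsStrandPair (f : MedialDart X → MedialDart X) (σ : X → Option Bool) (x : X)
    (p : MedialDart X) (u : List (MedialDart X)) (y q : MedialDart X) (v : List (MedialDart X))
    (z : MedialDart X) (D : List (List (MedialDart X))) : Prop where
  left : IsWalk f (mate σ) p u y
  right : IsWalk f (mate σ) q v z
  closed : ∀ w ∈ D, IsClosedWalk f (mate σ) w
  half : IsHalf f (p :: u ++ q :: v ++ D.flatten)
  hp : p.1.1 = x
  hq : q.1.1 = x
  ne_left : ∀ b ∈ u, b.1.1 ≠ x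
  ne_right : ∀ b ∈ v, b.1.1 ≠ x
  ne_rest : ∀ b ∈ D.flatten, b.1.1 ≠ x

namespace IsStrandPair

variable {f : MedialDart X → MedialDart X} {σ σ' : X → Option Bool} {x : X}
  {p y q z : MedialDart X} {u v : List (MedialDart X)} {D : List (List (MedialDart X))}

theorem congr (h : IsStrandPair f σ x p u y q v z D) (hσ : ∀ e ≠ x, σ e = σ' e) :
    IsStrandPair f σ' x p u y q v z D where
  left := h.left.congr (mate_involutive σ) (mate_involutive σ') fun b hb =>
    mate_congr (hσ _ (h.ne_left b hb))
  right := h.right.congr (mate_involutive σ) (mate_involutive σ') fun b hb =>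
    mate_congr (hσ _ (h.ne_right b hb))
  closed := fun w hw => (h.closed w hw).congr (mate_involutive σ) (mate_involutive σ') fun b hb =>
    mate_congr (hσ _ (h.ne_rest b (List.mem_flatten.2 ⟨w, hw, hb⟩)))
  __ := h

theorem isTrace_split (h : IsStrandPair f σ x p u y q v z D) (hp : p = mate σ y)
    (hq : q = mate σ z) : IsTrace f (mate σ) ((p :: u) :: (q :: v) :: D) :=
  ⟨by simpa only [List.forall_mem_cons] using ⟨⟨y, h.left, hp⟩, ⟨z, h.right, hq⟩, h.closed⟩,
    by simpa using h.half⟩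

theorem isTrace_join (h : IsStrandPair f σ x p u y q v z D) (hq : q = mate σ y)
    (hp : p = mate σ z) : IsTrace f (mate σ) ((p :: u ++ q :: v) :: D) :=
  ⟨List.forall_mem_cons.2 ⟨⟨z, isWalk_append.2 ⟨y, h.left, hq, h.right⟩, hp⟩, h.closed⟩, h.half⟩

theorem isTrace_join_reverse (hf : f.Involutive) (h : IsStrandPair f σ x p u y q v z D)
    (hz : z = mate σ y) (hp : p = mate σ q) :
    IsTrace f (mate σ) ((p :: u ++ z :: (v.map (mate σ)).reverse) :: D) :=
  ⟨List.forall_mem_cons.2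
      ⟨⟨q, isWalk_append.2 ⟨y, h.left, hz, h.right.reverse hf (mate_involutive σ)⟩, hp⟩, h.closed⟩,
    (h.half.append_map_append hf).perm
      (((h.right.reverse_perm (mate_involutive σ)).symm.append_left _).append_right _)⟩

end IsStrandPair

end States

section Signs

variable {X : Type*} {f : MedialDart X → MedialDart X} {σ σ' : X → Option Bool}
  {D : List (List (MedialDart X))}

/-- The sign `1` or `-1` of an end of an edge, used to compute the signs of the crossings. -/
def endSign (s : Bool) : ℤ := if s then 1 else -1

theorem endSign_not (s : Bool) : endSign (!s) = -endSign s := by cases s <;> rfl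

open Classical in
/-- The sign of the crossing of two visits at a vertex, given by their outgoing darts: it is `1` if
the first visit crosses the second one from right to left, `-1` if it does so from left to right,
and `0` if the darts do not belong to two visits that cross each other. -/
noncomputable def crossSign (σ : X → Option Bool) (a b : MedialDart X) : ℤ :=
  if a.1.1 = b.1.1 ∧ σ a.1.1 = none then
    endSign a.1.2 * endSign b.1.2 * (b.2.toInt - a.2.toInt)
  else 0

theorem crossSign_comm (σ : X → Option Bool) (a b : MedialDart X) :
    crossSign σ b a = -crossSign σ a b := by
  by_cases h : a.1.1 = b.1.1
  · simp only [crossSign, h, true_and]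
    split_ifs <;> ring
  · simp [crossSign, h, Ne.symm h]

theorem crossSign_congr {a b : MedialDart X} (h : σ a.1.1 = none ↔ σ' a.1.1 = none) :
    crossSign σ a b = crossSign σ' a b := by
  classical
  exact if_congr (and_congr_right fun _ => h) rfl rfl

theorem crossSign_of_ne_none {a : MedialDart X} (h : σ a.1.1 ≠ none) (b : MedialDart X) :
    crossSign σ a b = 0 := by
  simp [crossSign, h]

theorem crossSign_of_vertex_ne {a b : MedialDart X} (h : a.1.1 ≠ b.1.1) :
    crossSign σ a b = 0 := by
  simp [crossSign, h]

theorem crossSign_self (a : MedialDart X) : crossSign σ a a = 0 := by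
  simp [crossSign]

theorem crossSign_mate (σ : X → Option Bool) (a b : MedialDart X) :
    crossSign σ (mate σ a) b = -crossSign σ a b := by
  by_cases h : a.1.1 = b.1.1 ∧ σ a.1.1 = none
  · rw [crossSign, crossSign, if_pos h, if_pos (by rwa [mate_fst_fst]), mate, h.2]
    simp only [mateOf, endSign_not]
    ring
  · rw [crossSign, crossSign, if_neg h, if_neg (by rwa [mate_fst_fst]), neg_zero]

theorem crossSign_ne_zero {a b : MedialDart X} (h : crossSign σ a b ≠ 0) :
    a.1.1 = b.1.1 ∧ σ a.1.1 = none ∧ a.2 ≠ b.2 := by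
  unfold crossSign at h
  split_ifs at h with hcross
  · exact ⟨hcross.1, hcross.2, fun hab => h (by simp [hab])⟩
  · exact absurd rfl h

theorem crossSign_sq {a b : MedialDart X} (h : a.1.1 = b.1.1) (hσ : σ a.1.1 = none)
    (hab : a.2 ≠ b.2) : crossSign σ a b ^ 2 = 1 := by
  rcases a with ⟨⟨e, s⟩, t⟩
  rcases b with ⟨⟨e', s'⟩, t'⟩
  rw [crossSign, if_pos ⟨h, hσ⟩]
  cases s <;> cases s' <;> cases t <;> cases t' <;> simp_all [endSign]

theorem crossSign_congr_of_single_visit {x : X} (hσ : ∀ e ≠ x, σ e = σ' e) {a b : MedialDart X}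
    (hab : a.1.1 = x → b.1.1 = x → a = b) : crossSign σ a b = crossSign σ' a b := by
  by_cases ha : a.1.1 = x
  · by_cases hb : b.1.1 = x
    · rw [hab ha hb, crossSign_self, crossSign_self]
    · have hne : a.1.1 ≠ b.1.1 := by rw [ha]; exact Ne.symm hb
      rw [crossSign_of_vertex_ne hne, crossSign_of_vertex_ne hne]
  · exact crossSign_congr (by rw [hσ _ ha])

/-- The property of a surface that any two different curves of a state have algebraic intersection
number zero. -/
def Unlinked (f : MedialDart X → MedialDart X) : Prop :=
  ∀ (σ : X → Option Bool) (U V : List (MedialDart X)) (D : List (List (MedialDart X))),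
    IsTrace f (mate σ) (U :: V :: D) → crossSum (crossSign σ) U V = 0

namespace IsTrace

variable {p q : MedialDart X} {u v : List (MedialDart X)}

theorem snd_ne_of_crossing (h : IsTrace f (mate σ) D) {a b : MedialDart X} (ha : a ∈ D.flatten)
    (hb : b ∈ D.flatten) (hab : a.1.1 = b.1.1) (hσ : σ a.1.1 = none) (hne : a ≠ b) :
    a.2 ≠ b.2 := by
  intro hsnd
  refine h.apply_notMem (mate_involutive σ) ha ?_
  suffices mate σ a = b by rwa [this]
  rcases a with ⟨⟨e, s⟩, t⟩
  rcases b with ⟨⟨e', s'⟩, t'⟩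
  cases s <;> cases s' <;> simp_all [mate, mateOf]

theorem fst_snd_ne_of_cut (h : IsTrace f (mate σ) D) {a b : MedialDart X} (ha : a ∈ D.flatten)
    (hb : b ∈ D.flatten) (hab : a.1.1 = b.1.1) (hσ : σ a.1.1 = some false) (hne : a ≠ b) :
    a.1.2 ≠ b.1.2 := by
  intro hend
  refine h.apply_notMem (mate_involutive σ) ha ?_
  suffices mate σ a = b by rwa [this]
  rw [mate, hσ]
  exact Prod.ext (Prod.ext hab hend)
    (Bool.eq_not.2 fun hside => hne (Prod.ext (Prod.ext hab hend) hside.symm)).symm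

theorem eq_or_eq (h : IsTrace f (mate σ) D) {a b c : MedialDart X} (ha : a ∈ D.flatten)
    (hb : b ∈ D.flatten) (hc : c ∈ D.flatten) (hab : a.1.1 = b.1.1) (hca : c.1.1 = a.1.1)
    (hne : b ≠ a) : c = a ∨ c = b := by
  have hm {d d' : MedialDart X} (hd : d ∈ D.flatten) (hd' : d' ∈ D.flatten) : d' ≠ mate σ d := by
    rintro rfl
    exact h.apply_notMem (mate_involutive σ) hd hd'
  rcases eq_or_eq_mateOf_of_ne (σ a.1.1) hab hca hne (hm ha hb) with hc' | hc' | hc' | hc'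
  · exact .inl hc'
  · exact absurd hc' (hm ha hc)
  · exact .inr hc'
  · rw [hab] at hc'
    exact absurd hc' (hm hb hc)

theorem vertex_ne_of_perm (h : IsTrace f (mate σ) D) {l : List (MedialDart X)}
    (hl : D.flatten.Perm (p :: q :: l)) (hx : p.1.1 = q.1.1) : ∀ b ∈ l, b.1.1 ≠ p.1.1 := by
  intro b hb hbp
  obtain ⟨⟨hpq, hpl⟩, hql, -⟩ : (p ≠ q ∧ p ∉ l) ∧ q ∉ l ∧ l.Nodup := by
    simpa using hl.nodup_iff.1 h.half.nodup
  rcases h.eq_or_eq (hl.mem_iff.2 (by simp)) (hl.mem_iff.2 (by simp)) (hl.mem_iff.2 (by simp [hb]))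
    hx hbp hpq.symm with rfl | rfl
  · exact hpl hb
  · exact hql hb

theorem exists_isStrandPair_of_join (h : IsTrace f (mate σ) ((p :: u ++ q :: v) :: D))
    (hx : p.1.1 = q.1.1) :
    ∃ y z, IsStrandPair f σ p.1.1 p u y q v z D ∧ q = mate σ y ∧ p = mate σ z := by
  obtain ⟨z, hwalk, hz⟩ := h.closed _ (.head _)
  obtain ⟨y, hleft, hy, hright⟩ := isWalk_append.1 hwalk
  have hne := h.vertex_ne_of_perm (l := u ++ (v ++ D.flatten))
    (by simp) hx
  simp only [List.mem_append, or_imp, forall_and] at hne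
  exact ⟨y, z, ⟨hleft, hright, fun w hw => h.closed w (.tail _ hw), h.half, rfl, hx.symm, hne.1,
    hne.2.1, hne.2.2⟩, hy, hz⟩

theorem exists_isStrandPair_of_split (h : IsTrace f (mate σ) ((p :: u) :: (q :: v) :: D))
    (hx : p.1.1 = q.1.1) :
    ∃ y z, IsStrandPair f σ p.1.1 p u y q v z D ∧ p = mate σ y ∧ q = mate σ z := by
  obtain ⟨y, hleft, hy⟩ := h.closed _ (.head _)
  obtain ⟨z, hright, hz⟩ := h.closed _ (.tail _ (.head _))
  have hne := h.vertex_ne_of_perm (l := u ++ (v ++ D.flatten))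
    (by simp) hx
  simp only [List.mem_append, or_imp, forall_and] at hne
  exact ⟨y, z, ⟨hleft, hright, fun w hw => h.closed w (.tail _ (.tail _ hw)),
    by simpa using h.half, rfl, hx.symm, hne.1, hne.2.1, hne.2.2⟩, hy, hz⟩

end IsTrace

/-- The three ways to connect two strands `p :: u` and `q :: v` at the vertex `x`: the matching
`τs` closes each of them, while `τj` and `τr` join them to a single curve that follows the second
strand forwards, respectively backwards from its end `z`. -/
structure IsResolution [DecidableEq X] (f : MedialDart X → MedialDart X) (σ : X → Option Bool)
    (x : X) (p : MedialDart X) (u : List (MedialDart X)) (q : MedialDart X)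
    (v : List (MedialDart X)) (z : MedialDart X) (D : List (List (MedialDart X)))
    (τs τj τr : Option Bool) : Prop where
  hp : p.1.1 = x
  hq : q.1.1 = x
  hz : z.1.1 = x
  ne_left : ∀ b ∈ u, b.1.1 ≠ x
  ne_right : ∀ b ∈ v, b.1.1 ≠ x
  ne_rest : ∀ b ∈ D.flatten, b.1.1 ≠ x
  split : IsTrace f (mate (Function.update σ x τs)) ((p :: u) :: (q :: v) :: D)
  join : IsTrace f (mate (Function.update σ x τj)) ((p :: u ++ q :: v) :: D)
  joinReverse : IsTrace f (mate (Function.update σ x τr))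
    ((p :: u ++ z :: (v.map (mate σ)).reverse) :: D)
  split_ne_join : τs ≠ τj
  split_ne_joinReverse : τs ≠ τr
  join_ne_joinReverse : τj ≠ τr

section Resolution

variable [DecidableEq X] {x : X} {p y q z : MedialDart X} {u v : List (MedialDart X)}
  {τs τj τr : Option Bool}

theorem mate_update (σ : X → Option Bool) {d : MedialDart X} (hd : d.1.1 = x) (τ : Option Bool) :
    mate (Function.update σ x τ) d = mateOf τ d := by
  simp [mate, hd]

namespace IsStrandPair

theorem update (h : IsStrandPair f σ x p u y q v z D) (τ : Option Bool) :
    IsStrandPair f (Function.update σ x τ) x p u y q v z D :=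
  h.congr fun _ he => (Function.update_of_ne he _ _).symm

theorem isTrace_update_join_reverse (hf : f.Involutive) (h : IsStrandPair f σ x p u y q v z D)
    {τ : Option Bool} (hyx : y.1.1 = x) (hz : z = mateOf τ y) (hp : p = mateOf τ q) :
    IsTrace f (mate (Function.update σ x τ))
      ((p :: u ++ z :: (v.map (mate σ)).reverse) :: D) := by
  have hv : v.map (mate (Function.update σ x τ)) = v.map (mate σ) :=
    List.map_congr_left fun b hb => mate_congr (Function.update_of_ne (h.ne_right b hb) _ _)
  rw [← hv]
  exact (h.update τ).isTrace_join_reverse hf (by rwa [mate_update σ hyx])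
    (by rwa [mate_update σ h.hq])

end IsStrandPair

theorem IsTrace.exists_isResolution_of_split (hf : f.Involutive)
    (h : IsTrace f (mate σ) ((p :: u) :: (q :: v) :: D)) (hx : p.1.1 = q.1.1) :
    ∃ z τj τr, IsResolution f σ p.1.1 p u q v z D (σ p.1.1) τj τr := by
  obtain ⟨y, z, hs, hy, hz⟩ := h.exists_isStrandPair_of_split hx
  obtain ⟨τj, τr, hsj, hsr, hjr, hτr, hcomp⟩ := exists_matchings_of_ne (τ := σ p.1.1) hx
    (fun hqp => by simpa [hqp] using h.half.nodup)
    (fun hqp => h.apply_notMem (mate_involutive σ) (d := p) (by simp) (by simp [mate, ← hqp]))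
  have hyp : y = mateOf (σ p.1.1) p := by rw [← mate, hy, mate_mate]
  have hzq : z = mateOf (σ p.1.1) q := by rw [hx, ← mate, hz, mate_mate]
  have hyx : y.1.1 = p.1.1 := by rw [hyp, mateOf_fst_fst]
  have hzx : z.1.1 = p.1.1 := by rw [hzq, mateOf_fst_fst, hx]
  have hpq : p = mateOf τr q := by rw [hτr, mateOf_mateOf]
  refine ⟨z, τj, τr, rfl, hx.symm, hzx, hs.ne_left, hs.ne_right, hs.ne_rest,
    by rwa [Function.update_eq_self], (hs.update τj).isTrace_join ?_ ?_,
    hs.isTrace_update_join_reverse hf hyx ?_ hpq, hsj, hsr, hjr⟩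
  · rw [mate_update σ hyx, hyp, hcomp, hτr]
  · rw [mate_update σ hzx, hzq, hcomp, ← hpq]
  · rw [hyp, hzq, mateOf_comm, ← hτr]

theorem IsTrace.exists_isResolution_of_join (hf : f.Involutive)
    (h : IsTrace f (mate σ) ((p :: u ++ q :: v) :: D)) (hx : p.1.1 = q.1.1) :
    ∃ z τs τr, IsResolution f σ p.1.1 p u q v z D τs (σ p.1.1) τr := by
  obtain ⟨y, z, hs, hy, hz⟩ := h.exists_isStrandPair_of_join hx
  obtain ⟨τs, τr, hjs, hjr, hsr, hτr, hcomp⟩ := exists_matchings_of_ne (τ := σ p.1.1) hx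
    (fun hqp => by simpa [hqp] using h.half.nodup)
    (fun hqp => h.apply_notMem (mate_involutive σ) (d := p) (by simp) (by simp [mate, ← hqp]))
  have hyq : y = mateOf (σ p.1.1) q := by rw [hx, ← mate, hy, mate_mate]
  have hzp : z = mateOf (σ p.1.1) p := by rw [← mate, hz, mate_mate]
  have hyx : y.1.1 = p.1.1 := by rw [hyq, mateOf_fst_fst, hx]
  have hzx : z.1.1 = p.1.1 := by rw [hzp, mateOf_fst_fst]
  have hpq : p = mateOf τr q := by rw [hτr, mateOf_mateOf]
  refine ⟨z, τs, τr, rfl, hx.symm, hzx, hs.ne_left, hs.ne_right, hs.ne_rest,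
    (hs.update τs).isTrace_split ?_ ?_, by rwa [Function.update_eq_self],
    hs.isTrace_update_join_reverse hf hyx ?_ hpq, hjs.symm, hsr, hjr⟩
  · rw [mate_update σ hyx, hyq, hcomp, ← hpq]
  · rw [mate_update σ hzx, hzp, hcomp, hτr]
  · rw [hyq, hzp, mateOf_comm, ← hpq]

namespace IsResolution

theorem ne (h : IsResolution f σ x p u q v z D τs τj τr) : p ≠ q := fun hpq => by
  simpa [hpq] using h.split.half.nodup

theorem crossSum_eq_neg (hU : Unlinked f) (h : IsResolution f σ x p u q v z D τs τj τr) :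
    crossSum (crossSign σ) u v = -crossSign (Function.update σ x τs) p q := by
  have hsum := hU _ _ _ _ h.split
  have hpv : v.map (crossSign (Function.update σ x τs) p) = v.map fun _ => 0 :=
    List.map_congr_left fun b hb =>
      crossSign_of_vertex_ne (by rw [h.hp]; exact Ne.symm (h.ne_right b hb))
  have huq : u.map (crossSign (Function.update σ x τs) · q) = u.map fun _ => 0 :=
    List.map_congr_left fun a ha => crossSign_of_vertex_ne (by rw [h.hq]; exact h.ne_left a ha)
  have huv : crossSum (crossSign (Function.update σ x τs)) u v = crossSum (crossSign σ) u v :=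
    crossSum_congr fun a ha b _ =>
      crossSign_congr (by rw [Function.update_of_ne (h.ne_left a ha)])
  rw [crossSum_cons_left, crossSum_cons_right, List.map_cons, List.sum_cons, hpv, huq, huv,
    List.sum_map_zero, List.sum_map_zero] at hsum
  linarith

theorem crossSum_eq_zero (hU : Unlinked f) (h : IsResolution f σ x p u q v z D τs τj τr)
    (hτ : τs ≠ none) : crossSum (crossSign σ) u v = 0 := by
  rw [h.crossSum_eq_neg hU, crossSign_of_ne_none (by simpa [h.hp] using hτ), neg_zero]

theorem sq_crossSum_eq_one (hU : Unlinked f) (h : IsResolution f σ x p u q v z D none τj τr) :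
    crossSum (crossSign σ) u v ^ 2 = 1 := by
  have hpq : p.1.1 = q.1.1 := h.hp.trans h.hq.symm
  have hcross : Function.update σ x none p.1.1 = none := by simp [h.hp]
  rw [h.crossSum_eq_neg hU, neg_sq, crossSign_sq hpq hcross
    (h.split.snd_ne_of_crossing (by simp) (by simp) hpq hcross h.ne)]

end IsResolution

end Resolution

theorem IsTrace.crossSum_eq_zero_of_join {p q : MedialDart X} {u v : List (MedialDart X)}
    (hf : f.Involutive) (hU : Unlinked f) (h : IsTrace f (mate σ) ((p :: u ++ q :: v) :: D))
    (hpq : crossSign σ p q ≠ 0) :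
    crossSum (crossSign σ) u v = 0 := by
  classical
  obtain ⟨hx, hσ, -⟩ := crossSign_ne_zero hpq
  obtain ⟨z, τs, τr, hr⟩ := h.exists_isResolution_of_join hf hx
  exact hr.crossSum_eq_zero hU (hσ ▸ hr.split_ne_join)

theorem IsTrace.weight_rotate (hf : f.Involutive) (hU : Unlinked f) {u v : List (MedialDart X)}
    (h : IsTrace f (mate σ) ((u ++ v) :: D)) :
    weight (crossSign σ) (v ++ u) = weight (crossSign σ) (u ++ v) := by
  classical
  induction u generalizing v with
  | nil => simp
  | cons a u ih =>
    have hrot : IsTrace f (mate σ) ((u ++ (v ++ [a])) :: D) := by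
      simpa using IsTrace.rotate (u := [a]) (v := u ++ v) (by simpa using h)
    rw [show v ++ a :: u = (v ++ [a]) ++ u by simp, ih hrot, ← List.append_assoc,
      weight_rotate_one (crossSign_comm σ), List.cons_append]
    intro w₁ k w₂ hw hk
    refine IsTrace.crossSum_eq_zero_of_join hf hU (p := a) (q := k) (D := D) ?_ hk
    rw [List.cons_append, ← hw]
    exact h

end Signs

section StateSum

variable {X : Type*} {f : MedialDart X → MedialDart X} {σ σ' : X → Option Bool}
  {D : List (List (MedialDart X))} {x : X} {p q : MedialDart X} {u v : List (MedialDart X)}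

/-- The total weight of the curves of a state. -/
noncomputable def totalWeight (σ : X → Option Bool) (D : List (List (MedialDart X))) : ℤ :=
  (D.map (weight (crossSign σ))).sum

theorem totalWeight_cons (w : List (MedialDart X)) :
    totalWeight σ (w :: D) = weight (crossSign σ) w + totalWeight σ D := by
  rw [totalWeight, List.map_cons, List.sum_cons, totalWeight]

theorem totalWeight_perm {D' : List (List (MedialDart X))} (h : D.Perm D') :
    totalWeight σ D = totalWeight σ D' := (h.map _).sum_eq

theorem totalWeight_congr (h : ∀ b ∈ D.flatten, σ b.1.1 = σ' b.1.1) :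
    totalWeight σ D = totalWeight σ' D :=
  congrArg _ (List.map_congr_left fun w hw => weight_congr fun a ha _ _ =>
    crossSign_congr (by rw [h a (List.mem_flatten.2 ⟨w, hw, ha⟩)]))

/-- The quantity whose sum over the three resolutions of a crossing vanishes. The number `n` stands
for the number of crossings of the state. -/
noncomputable def potential (σ : X → Option Bool) (D : List (List (MedialDart X))) (n : ℤ) : ℤ :=
  (-2) ^ D.length * (2 * D.length + n + 3 * totalWeight σ D)

theorem weight_append_cons_of_single_visit (hσ : ∀ e ≠ x, σ e = σ' e) (hq : q.1.1 = x)
    (hu : ∀ b ∈ u, b.1.1 ≠ x) (hv : ∀ b ∈ v, b.1.1 ≠ x) :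
    weight (crossSign σ) (u ++ q :: v) = weight (crossSign σ') (u ++ v) := by
  classical
  set σ₀ := Function.update σ x (some true)
  have hσ₀ (e : X) (he : e ≠ x) : σ e = σ₀ e := (Function.update_of_ne he _ _).symm
  have eq_of_visit {a : MedialDart X} (ha : a ∈ u ++ q :: v) (hax : a.1.1 = x) : a = q := by
    grind
  have hq₀ (b : MedialDart X) : crossSign σ₀ q b = 0 :=
    crossSign_of_ne_none (by simp [σ₀, hq]) b
  calc weight (crossSign σ) (u ++ q :: v)
      = weight (crossSign σ₀) (u ++ q :: v) :=
        weight_congr fun a ha b hb => crossSign_congr_of_single_visit hσ₀ fun hax hbx =>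
          (eq_of_visit ha hax).trans (eq_of_visit hb hbx).symm
    _ = weight (crossSign σ₀) (u ++ v) := weight_append_cons_of_null (crossSign_comm _) hq₀ u v
    _ = weight (crossSign σ') (u ++ v) := weight_congr fun a ha _ _ => crossSign_congr <| by
        have hax : a.1.1 ≠ x := (List.mem_append.1 ha).elim (hu a) (hv a)
        rw [← hσ₀ _ hax, hσ _ hax]

theorem weight_cons_of_single_visit (hσ : ∀ e ≠ x, σ e = σ' e) (hp : p.1.1 = x)
    (hu : ∀ b ∈ u, b.1.1 ≠ x) : weight (crossSign σ) (p :: u) = weight (crossSign σ') u :=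
  weight_append_cons_of_single_visit (u := []) hσ hp (by simp) hu

theorem weight_join_of_ne_none (hσ : ∀ e ≠ x, σ e = σ' e) (hx : σ x ≠ none) (hp : p.1.1 = x)
    (hq : q.1.1 = x) (hu : ∀ b ∈ u, b.1.1 ≠ x) (hv : ∀ b ∈ v, b.1.1 ≠ x) :
    weight (crossSign σ) (p :: u ++ q :: v) = weight (crossSign σ') (u ++ v) := by
  rw [List.cons_append,
    weight_cons_of_null (crossSign_comm σ) (crossSign_of_ne_none (by rwa [hp])),
    weight_append_cons_of_single_visit hσ hq hu hv]

namespace IsTrace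

theorem weight_join_of_crossing (hf : f.Involutive) (hU : Unlinked f)
    (h : IsTrace f (mate σ) ((p :: u ++ q :: v) :: D)) (hpq : p.1.1 = q.1.1)
    (hσ : σ p.1.1 = none) (hu : ∀ b ∈ u, b.1.1 ≠ p.1.1) (hv : ∀ b ∈ v, b.1.1 ≠ p.1.1) :
    weight (crossSign σ) (p :: u ++ q :: v) = weight (crossSign σ) (u ++ q :: v) + 1 := by
  have hne : p ≠ q := fun hpq => by simpa [hpq] using h.half.nodup
  have hsq := crossSign_sq hpq hσ (h.snd_ne_of_crossing (by simp) (by simp) hpq hσ hne)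
  have hzero {w : List (MedialDart X)} (hw : ∀ b ∈ w, b.1.1 ≠ p.1.1) :
      (w.map (crossSign σ p · ^ 2)).sum = 0 := by
    rw [List.map_congr_left fun b hb => by rw [crossSign_of_vertex_ne (hw b hb).symm],
      zero_pow two_ne_zero, List.sum_map_zero]
  have hcons : interleavedSum (crossSign σ) (p :: (u ++ q :: v)) =
      interleavedSum (crossSign σ) (u ++ q :: v) :=
    interleavedSum_cons p _ fun w₁ k w₂ hw hk =>
      crossSum_eq_zero_of_join hf hU (D := D) (by rwa [List.cons_append, ← hw]) hk
  rw [weight, weight, List.cons_append, hcons, pairSum, List.map_append, List.map_cons,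
    List.sum_append, List.sum_cons, hzero hu, hzero hv, hsq]
  ring

theorem crossSign_mul_crossSign_eq_zero (h : IsTrace f (mate σ) D) {a b : MedialDart X}
    (ha : a ∈ D.flatten) (hb : b ∈ D.flatten) (hab : a ≠ b) (c : MedialDart X) :
    crossSign σ a c * crossSign σ b c = 0 := by
  by_contra hne
  obtain ⟨hac, hσ, ha₂⟩ := crossSign_ne_zero (left_ne_zero_of_mul hne)
  obtain ⟨hbc, -, hb₂⟩ := crossSign_ne_zero (right_ne_zero_of_mul hne)
  refine h.snd_ne_of_crossing ha hb (hac.trans hbc.symm) hσ hab ?_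
  exact (Bool.eq_not.2 ha₂).trans (Bool.eq_not.2 hb₂).symm

theorem pairwise_crossSign_mul_eq_zero (h : IsTrace f (mate σ) D) {w : List (MedialDart X)}
    (hw : w.Sublist D.flatten) (hσ : ∀ b ∈ w, σ b.1.1 = σ' b.1.1) :
    w.Pairwise fun a b => ∀ c, crossSign σ' a c * crossSign σ' b c = 0 := by
  refine List.Pairwise.imp_of_mem (fun {a b} ha hb hab c => ?_) (h.half.nodup.sublist hw)
  have hcongr {a : MedialDart X} (ha : a ∈ w) : crossSign σ' a c = crossSign σ a c :=
    crossSign_congr (by rw [hσ a ha])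
  rw [hcongr ha, hcongr hb]
  exact h.crossSign_mul_crossSign_eq_zero (hw.subset ha) (hw.subset hb) hab c

theorem tripleSum_eq_zero (hf : f.Involutive) (hU : Unlinked f)
    (h : IsTrace f (mate σ) (u :: v :: D)) :
    tripleSum (fun i j k => crossSign σ i k * (v.map (crossSign σ j)).sum) u = 0 := by
  classical
  refine tripleSum_eq_zero_of_between u fun w₁ i w₂ k w₃ hu hik => ?_
  obtain ⟨hx, hσ, -⟩ := crossSign_ne_zero hik
  have hrot : IsTrace f (mate σ) ((i :: w₂ ++ k :: (w₃ ++ w₁)) :: v :: D) := by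
    simpa using IsTrace.rotate (u := w₁) (v := i :: w₂ ++ k :: w₃) (by simpa [hu] using h)
  obtain ⟨z, τs, τr, hr⟩ := hrot.exists_isResolution_of_join hf hx
  have hi := crossSign_of_ne_none (σ := Function.update σ i.1.1 τs) (a := i)
    (by simpa [hσ] using hr.split_ne_join)
  have hw₂ := hU _ _ _ _ (hr.split.perm ((List.Perm.swap _ _ _).cons _))
  rw [crossSum_cons_left, List.map_congr_left fun b _ => hi b, List.sum_map_zero, zero_add] at hw₂
  rw [← hw₂]
  exact crossSum_congr fun a ha b _ =>
    crossSign_congr (by rw [Function.update_of_ne (hr.ne_left a ha)])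

theorem tripleSum_strand_eq_zero (hf : f.Involutive) (hU : Unlinked f)
    (h : IsTrace f (mate σ) ((p :: u) :: (q :: v) :: D)) (hσ : ∀ e ≠ x, σ e = σ' e)
    (hp : p.1.1 = x) (hq : q.1.1 = x) (hu : ∀ b ∈ u, b.1.1 ≠ x) :
    tripleSum (fun i j k => crossSign σ' i k * (v.map (crossSign σ' j)).sum) u = 0 := by
  have hsum := h.tripleSum_eq_zero hf hU
  have hpu (b : MedialDart X) (hb : b ∈ u) : crossSign σ p b = 0 :=
    crossSign_of_vertex_ne (by rw [hp]; exact (hu b hb).symm)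
  have huq (b : MedialDart X) (hb : b ∈ u) : crossSign σ b q = 0 :=
    crossSign_of_vertex_ne (by rw [hq]; exact hu b hb)
  have hcongr (b : MedialDart X) (hb : b ∈ u) (c : MedialDart X) :
      crossSign σ b c = crossSign σ' b c := crossSign_congr (by rw [hσ _ (hu b hb)])
  rw [tripleSum, pairSum_eq_zero (List.pairwise_of_forall_mem_list fun j _ k hk => by
    rw [hpu k hk, zero_mul]), zero_add] at hsum
  rw [← hsum]
  refine tripleSum_congr fun i hi j hj _ _ => ?_
  rw [List.map_cons, List.sum_cons, huq j hj, zero_add, hcongr i hi,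
    List.map_congr_left fun b _ => hcongr j hj b]

end IsTrace

section Resolution

variable [DecidableEq X] {z : MedialDart X} {τs τj τr : Option Bool}

namespace IsResolution

theorem weight_add_weight_reverse (hf : f.Involutive) (hU : Unlinked f)
    (h : IsResolution f σ x p u q v z D τs τj τr) :
    weight (crossSign σ) (u ++ v) + weight (crossSign σ) (u ++ (v.map (mate σ)).reverse) =
      2 * (weight (crossSign σ) u + weight (crossSign σ) v) +
        2 * crossSum (crossSign σ) u v ^ 2 := by
  have hσ (e : X) (he : e ≠ x) : Function.update σ x τs e = σ e := Function.update_of_ne he _ _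
  refine weight_append_add_weight_append_reverse (crossSign_comm σ) (crossSign_mate σ)
    ?_ ?_ (h.split.tripleSum_strand_eq_zero hf hU hσ h.hp h.hq h.ne_left)
    ((h.split.perm (.swap _ _ _)).tripleSum_strand_eq_zero hf hU hσ h.hq h.hp h.ne_right)
  · refine (h.split.pairwise_crossSign_mul_eq_zero ?_ fun b hb => hσ _ (h.ne_left b hb)).imp
      fun hab c _ => hab c
    exact (List.sublist_append_left u _).cons p
  · refine (h.split.pairwise_crossSign_mul_eq_zero ?_ fun b hb => hσ _ (h.ne_right b hb)).imp
      fun hab c _ => ?_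
    · exact ((List.sublist_append_left v _).cons q).trans (List.sublist_append_right (p :: u) _)
    · rw [crossSign_comm _ _ c, crossSign_comm _ _ c, neg_mul_neg]
      exact hab c

theorem weight_join (hf : f.Involutive) (hU : Unlinked f)
    (h : IsResolution f σ x p u q v z D τs τj τr) :
    weight (crossSign (Function.update σ x τj)) (p :: u ++ q :: v) =
      weight (crossSign σ) (u ++ v) + if τj = none then 1 else 0 := by
  have hσ (e : X) (he : e ≠ x) : Function.update σ x τj e = σ e := Function.update_of_ne he _ _
  split_ifs with hτj
  · have hx := h.hp
    subst hx
    rw [h.join.weight_join_of_crossing hf hU h.hq.symm (by simp [hτj]) h.ne_left h.ne_right,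
      weight_append_cons_of_single_visit hσ h.hq h.ne_left h.ne_right]
  · rw [add_zero, weight_join_of_ne_none hσ (by simpa) h.hp h.hq h.ne_left h.ne_right]

theorem weight_joinReverse (h : IsResolution f σ x p u q v z D τs τj τr) (hτr : τr ≠ none) :
    weight (crossSign (Function.update σ x τr)) (p :: u ++ z :: (v.map (mate σ)).reverse) =
      weight (crossSign σ) (u ++ (v.map (mate σ)).reverse) := by
  refine weight_join_of_ne_none (fun e he => Function.update_of_ne he _ _) (by simpa) h.hp h.hz
    h.ne_left fun b hb => ?_
  obtain ⟨a, ha, rfl⟩ := List.mem_map.1 (List.mem_reverse.1 hb)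
  rw [mate_fst_fst]
  exact h.ne_right a ha

theorem sq_crossSum_eq_ite (hU : Unlinked f) (h : IsResolution f σ x p u q v z D τs τj τr) :
    crossSum (crossSign σ) u v ^ 2 = if τs = none then 1 else 0 := by
  split_ifs with hτs
  · subst hτs
    exact h.sq_crossSum_eq_one hU
  · rw [h.crossSum_eq_zero hU hτs, zero_pow two_ne_zero]

theorem potential_add (hf : f.Involutive) (hU : Unlinked f)
    (h : IsResolution f σ x p u q v z D τs τj τr) (hτr : τr ≠ none) (n : ℤ) :
    potential (Function.update σ x τs) ((p :: u) :: (q :: v) :: D)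
        (n + if τs = none then 1 else 0) +
      potential (Function.update σ x τj) ((p :: u ++ q :: v) :: D)
        (n + if τj = none then 1 else 0) +
      potential (Function.update σ x τr) ((p :: u ++ z :: (v.map (mate σ)).reverse) :: D) n =
        0 := by
  have hσ (τ : Option Bool) (e : X) (he : e ≠ x) : Function.update σ x τ e = σ e :=
    Function.update_of_ne he _ _
  have hrest (τ : Option Bool) : totalWeight (Function.update σ x τ) D = totalWeight σ D :=
    totalWeight_congr fun b hb => hσ τ _ (h.ne_rest b hb)
  have hcrossing : (if τs = none then 1 else 0 : ℤ) + (if τj = none then 1 else 0) = 1 :=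
    (show ∀ a b c : Option Bool, c ≠ none → a ≠ b → a ≠ c → b ≠ c →
      (if a = none then 1 else 0 : ℤ) + (if b = none then 1 else 0) = 1 by decide) τs τj τr hτr
      h.split_ne_join h.split_ne_joinReverse h.join_ne_joinReverse
  have hweight := h.weight_add_weight_reverse hf hU
  rw [h.sq_crossSum_eq_ite hU] at hweight
  simp only [potential, totalWeight_cons, hrest, h.weight_join hf hU, h.weight_joinReverse hτr,
    weight_cons_of_single_visit (hσ τs) h.hp h.ne_left,
    weight_cons_of_single_visit (hσ τs) h.hq h.ne_right, List.length_cons, pow_succ]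
  push_cast
  linear_combination (-2) ^ D.length * (-6 * hweight - 8 * hcrossing)

end IsResolution

end Resolution

namespace IsTrace

variable {C : List (List (MedialDart X))}

theorem exists_cons (hf : f.Involutive) (hU : Unlinked f) (h : IsTrace f (mate σ) (C ++ D))
    {d : MedialDart X} (hd : d ∈ D.flatten) :
    ∃ w D', IsTrace f (mate σ) (C ++ (d :: w) :: D') ∧ D.length = D'.length + 1 ∧
      totalWeight σ D = totalWeight σ ((d :: w) :: D') ∧ D.flatten ⊆ d :: w ++ D'.flatten := by
  obtain ⟨c, hc, hdc⟩ := List.mem_flatten.1 hd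
  obtain ⟨D₁, D₂, rfl⟩ := List.append_of_mem hc
  obtain ⟨s, t, rfl⟩ := List.append_of_mem hdc
  have hperm : (D₁ ++ (s ++ d :: t) :: D₂).Perm ((s ++ d :: t) :: (D₁ ++ D₂)) :=
    List.perm_middle
  have hfront := h.perm ((hperm.append_left C).trans List.perm_middle)
  refine ⟨t ++ s, D₁ ++ D₂, ?_, by simpa using hperm.length_eq, ?_, fun b hb => ?_⟩
  · exact (hfront.rotate).perm List.perm_middle.symm
  · rw [totalWeight_perm hperm, totalWeight_cons, totalWeight_cons, ← hfront.weight_rotate hf hU,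
      List.cons_append]
  · have := hperm.flatten.mem_iff.1 hb
    simp only [List.flatten_cons, List.mem_append, List.mem_cons] at this ⊢
    tauto

theorem exists_two_visits (hf : f.Involutive) (h : IsTrace f (mate σ) D) (x : X) :
    ∃ p ∈ D.flatten, ∃ q ∈ D.flatten, p.1.1 = x ∧ q.1.1 = x ∧ q ≠ p := by
  obtain ⟨p, hp, hpx⟩ : ∃ p ∈ D.flatten, p.1.1 = x :=
    (h.mem_or_apply_mem hf ((x, true), true)).elim (fun hd => ⟨_, hd, rfl⟩) fun hd =>
      ⟨_, hd, mate_fst_fst ..⟩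
  obtain ⟨τ, hτ⟩ := exists_ne (σ x)
  refine ⟨p, hp, ?_⟩
  rcases h.mem_or_apply_mem hf (mateOf τ p) with hq | hq
  · exact ⟨_, hq, hpx, by rw [mateOf_fst_fst, hpx], mateOf_ne τ p⟩
  · refine ⟨_, hq, hpx, by rw [mate_fst_fst, mateOf_fst_fst, hpx], fun hqp => hτ ?_⟩
    refine mateOf_left_injective p ?_
    change mateOf τ p = mateOf (σ x) p
    rw [← hpx, ← mate, ← hqp, mate_mate, hqp]

theorem exists_strands (hf : f.Involutive) (hU : Unlinked f) (h : IsTrace f (mate σ) D) (x : X) :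
    ∃ D₁ p u q v D', p.1.1 = x ∧ q.1.1 = x ∧ IsTrace f (mate σ) D₁ ∧ D.length = D₁.length ∧
      totalWeight σ D = totalWeight σ D₁ ∧
      (D₁ = (p :: u) :: (q :: v) :: D' ∨ D₁ = (p :: u ++ q :: v) :: D') := by
  obtain ⟨p, hp, q, hq, hpx, hqx, hqp⟩ := h.exists_two_visits hf x
  obtain ⟨w, D₁, h₁, hlen₁, hw₁, hsub⟩ := exists_cons (C := []) hf hU h hp
  rcases List.mem_append.1 (hsub hq) with hqw | hqD
  · obtain ⟨u, v, rfl⟩ := List.append_of_mem ((List.mem_cons.1 hqw).resolve_left hqp)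
    exact ⟨_, p, u, q, v, D₁, hpx, hqx, h₁, by simpa using hlen₁, hw₁, .inr rfl⟩
  · obtain ⟨v, D₂, h₂, hlen₂, hw₂, -⟩ := exists_cons (C := [p :: w]) hf hU h₁ hqD
    refine ⟨_, p, w, q, v, D₂, hpx, hqx, h₂, by simp [hlen₁, hlen₂], ?_, .inl rfl⟩
    rw [hw₁, totalWeight_cons, hw₂]
    exact (totalWeight_cons _).symm

theorem exists_smoothings [DecidableEq X] (hf : f.Involutive) (hU : Unlinked f)
    (h : IsTrace f (mate σ) D) (hx : σ x = none) :
    ∃ (D₂ D₃ : List (List (MedialDart X))) (τ τ' : Option Bool), τ ≠ none ∧ τ' ≠ none ∧ τ ≠ τ' ∧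
      IsTrace f (mate (Function.update σ x τ)) D₂ ∧
      IsTrace f (mate (Function.update σ x τ')) D₃ ∧
      (-2 : ℤ) ^ D.length + (-2) ^ D₂.length + (-2) ^ D₃.length = 0 ∧
      ∀ n, potential σ D (n + 1) + potential (Function.update σ x τ) D₂ n +
        potential (Function.update σ x τ') D₃ n = 0 := by
  obtain ⟨D₁, p, u, q, v, D', rfl, hq, h₁, hlen, hweight, hD₁⟩ := h.exists_strands hf hU x
  have hD₁n (n : ℤ) : potential σ D n = potential σ D₁ n := by
    rw [potential, potential, hlen, hweight]
  have hupdate : Function.update σ p.1.1 none = σ := by rw [← hx, Function.update_eq_self]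
  simp only [hD₁n, hlen]
  rcases hD₁ with rfl | rfl
  · obtain ⟨z, τj, τr, hr⟩ := h₁.exists_isResolution_of_split hf hq.symm
    have hτj := hx ▸ hr.split_ne_join.symm
    have hτr := hx ▸ hr.split_ne_joinReverse.symm
    refine ⟨_, _, τj, τr, hτj, hτr, hr.join_ne_joinReverse, hr.join, hr.joinReverse, ?_,
      fun n => ?_⟩
    · simp only [List.length_cons, pow_succ]
      ring
    · simpa [hx, hupdate, hτj] using hr.potential_add hf hU hτr n
  · obtain ⟨z, τs, τr, hr⟩ := h₁.exists_isResolution_of_join hf hq.symm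
    have hτs := hx ▸ hr.split_ne_join
    have hτr := hx ▸ hr.join_ne_joinReverse.symm
    refine ⟨_, _, τs, τr, hτs, hτr, hr.split_ne_joinReverse, hr.split, hr.joinReverse, ?_,
      fun n => ?_⟩
    · simp only [List.length_cons, pow_succ]
      ring
    · simpa [hx, hupdate, hτs, add_comm (potential σ _ (n + 1))] using hr.potential_add hf hU hτr n

end IsTrace

end StateSum

section Loops

variable {α : Type*} {f m : α → α} {w : List α} {D : List (List α)}

/-- Two half-edges are related if they are the two halves of an edge or are joined at a vertex. -/
def HalfEdgeRel (f m : α → α) (a b : α) : Prop := b = f a ∨ b = m a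

/-- The closed curves, without a direction. -/
def Loop (f m : α → α) : Type _ := Quot (HalfEdgeRel f m)

/-- The number of closed curves. -/
noncomputable def numLoops (f m : α → α) : ℕ := Nat.card (Loop f m)

/-- The closed curve that contains a half-edge. -/
def loopOf (f m : α → α) (d : α) : Loop f m := Quot.mk _ d

theorem loopOf_surjective : Function.Surjective (loopOf f m) := Quot.mk_surjective

theorem loopOf_left (d : α) : loopOf f m (f d) = loopOf f m d := (Quot.sound (.inl rfl)).symm

theorem loopOf_right (d : α) : loopOf f m (m d) = loopOf f m d := (Quot.sound (.inr rfl)).symm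

theorem IsWalk.loopOf_eq {p z : α} (h : IsWalk f m p w z) :
    ∀ a ∈ p :: w, loopOf f m a = loopOf f m p := by
  induction w generalizing p with
  | nil => simp
  | cons b w ih =>
    obtain ⟨rfl, hwalk⟩ := h
    rw [List.forall_mem_cons]
    exact ⟨rfl, fun a ha => by rw [ih hwalk a ha, loopOf_right, loopOf_left]⟩

namespace IsClosedWalk

theorem loopOf_eq (h : IsClosedWalk f m w) {a b : α} (ha : a ∈ w) (hb : b ∈ w) :
    loopOf f m a = loopOf f m b := by
  cases w with
  | nil => simp at ha
  | cons p w =>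
    obtain ⟨z, hwalk, -⟩ := h
    rw [hwalk.loopOf_eq a ha, hwalk.loopOf_eq b hb]

theorem mem_or_left_mem_of_loopOf_eq (hf : f.Involutive) (hm : m.Involutive)
    (h : IsClosedWalk f m w) {a b : α} (hab : loopOf f m a = loopOf f m b)
    (ha : a ∈ w ∨ f a ∈ w) : b ∈ w ∨ f b ∈ w := by
  let visited : Loop f m → Prop := Quot.lift (fun d => d ∈ w ∨ f d ∈ w) (by
    rintro a b (rfl | rfl)
    · rw [hf, or_comm]
    · rw [h.left_mem_iff hf hm (a := a), h.left_mem_iff hf hm (a := m a), hm, or_comm])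
  have hvisited : visited (loopOf f m a) := ha
  rwa [hab] at hvisited

end IsClosedWalk

theorem IsTrace.length_eq (hf : f.Involutive) (hm : m.Involutive) (h : IsTrace f m D) :
    D.length = numLoops f m := by
  have hclosed (i : Fin D.length) : IsClosedWalk f m (D.get i) := h.closed _ (D.get_mem i)
  have exists_mem (i : Fin D.length) : ∃ d, d ∈ D.get i :=
    List.exists_mem_of_ne_nil _ fun hnil => (hnil ▸ hclosed i : IsClosedWalk f m [])
  choose r hr using exists_mem
  have mem_flatten {i : Fin D.length} {d : α} (hd : d ∈ D.get i) : d ∈ D.flatten :=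
    List.mem_flatten.2 ⟨_, D.get_mem i, hd⟩
  suffices Function.Bijective fun i => loopOf f m (r i) by
    rw [numLoops, ← Nat.card_eq_of_bijective _ this, Nat.card_fin]
  refine ⟨fun i j hij => ?_, fun c => ?_⟩
  · have hrj : r j ∈ D.get i :=
      ((hclosed i).mem_or_left_mem_of_loopOf_eq hf hm hij (.inl (hr i))).resolve_right
        fun hfr => h.half.notMem (mem_flatten (hr j)) (mem_flatten hfr)
    have hdisjoint := List.pairwise_iff_getElem.1 (List.nodup_flatten.1 h.half.nodup).2
    by_contra hne
    rcases lt_or_gt_of_ne hne with hlt | hlt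
    · exact hdisjoint i j i.2 j.2 hlt hrj (hr j)
    · exact hdisjoint j i j.2 i.2 hlt (hr j) hrj
  · obtain ⟨d, rfl⟩ := loopOf_surjective c
    rcases h.half.mem_or hf d with hd | hd <;> obtain ⟨w, hw, hdw⟩ := List.mem_flatten.1 hd <;>
      obtain ⟨i, rfl⟩ := List.get_of_mem hw <;> refine ⟨i, ?_⟩
    · exact (hclosed i).loopOf_eq (hr i) hdw
    · exact ((hclosed i).loopOf_eq (hr i) hdw).trans (loopOf_left d)

end Loops

section Existence

variable {α : Type*} {f m : α → α}

theorem iterate_comp_left_iterate (hf : f.Involutive) (hm : m.Involutive) (n : ℕ) (d : α) :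
    (m ∘ f)^[n] (f ((m ∘ f)^[n] d)) = f d := by
  induction n with
  | zero => rfl
  | succ n ih =>
    rw [Function.iterate_succ_apply, Function.iterate_succ_apply', Function.comp_apply,
      Function.comp_apply, hf, hm, ih]

theorem iterate_comp_ne_left (hf : f.Involutive) (hm : m.Involutive) (hf_ne : ∀ d, f d ≠ d)
    (hm_ne : ∀ d, m d ≠ d) (n : ℕ) (d : α) : (m ∘ f)^[n] d ≠ f d := by
  have hinj (k : ℕ) : Function.Injective (m ∘ f)^[k] := (hm.injective.comp hf.injective).iterate k
  intro h
  obtain ⟨k, rfl | rfl⟩ := Nat.even_or_odd' n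
  · rw [two_mul, Function.iterate_add_apply, ← iterate_comp_left_iterate hf hm k d] at h
    exact hf_ne _ (hinj k h).symm
  · rw [two_mul, add_assoc, Function.iterate_add_apply,
      ← iterate_comp_left_iterate hf hm k d] at h
    have hstep := hinj k h
    rw [Function.iterate_succ_apply'] at hstep
    exact hm_ne _ hstep

/-- The half-edges along which the curve through a given half-edge leaves the vertices, starting
with this half-edge. -/
noncomputable def orbitList (f m : α → α) (d : α) : List α :=
  (List.range (Function.minimalPeriod (m ∘ f) d)).map fun i => (m ∘ f)^[i] d

theorem orbitList_nodup (d : α) : (orbitList f m d).Nodup := Function.nodup_periodicOrbit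

theorem isWalk_iterate (d : α) (n : ℕ) :
    IsWalk f m d ((List.range n).map fun i => (m ∘ f)^[i + 1] d) (f ((m ∘ f)^[n] d)) := by
  induction n with
  | zero => rfl
  | succ n ih =>
    rw [List.range_succ, List.map_append]
    exact isWalk_append.2 ⟨_, ih, Function.iterate_succ_apply' _ _ _, rfl⟩

theorem isHalf_of_forall (hf : f.Involutive) {l : List α} (hl : l.Nodup)
    (hdisjoint : ∀ d ∈ l, f d ∉ l) (hmem : ∀ d, d ∈ l ∨ f d ∈ l) : IsHalf f l := by
  refine ⟨List.nodup_append.2 ⟨hl, hl.map hf.injective, ?_⟩, fun d => ?_⟩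
  · rintro a ha b hb rfl
    obtain ⟨d, hd, rfl⟩ := List.mem_map.1 hb
    exact hdisjoint d hd ha
  · simpa [List.mem_map, hf.eq_iff] using hmem d

variable [Finite α]

theorem mem_orbitList (hf : f.Involutive) (hm : m.Involutive) {d e : α} :
    e ∈ orbitList f m d ↔ ∃ n, (m ∘ f)^[n] d = e :=
  Function.mem_periodicOrbit_iff ((hm.injective.comp hf.injective).mem_periodicPts d)

theorem self_mem_orbitList (hf : f.Involutive) (hm : m.Involutive) (d : α) :
    d ∈ orbitList f m d :=
  (mem_orbitList hf hm).2 ⟨0, rfl⟩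

theorem isClosedWalk_orbitList (hf : f.Involutive) (hm : m.Involutive) (d : α) :
    IsClosedWalk f m (orbitList f m d) := by
  have hpos := Function.minimalPeriod_pos_of_mem_periodicPts
    ((hm.injective.comp hf.injective).mem_periodicPts d)
  have hper := Function.isPeriodicPt_minimalPeriod (m ∘ f) d
  obtain ⟨n, hn⟩ := Nat.exists_eq_add_one.2 hpos
  rw [orbitList, hn, List.range_succ_eq_map, List.map_cons, List.map_map]
  refine ⟨_, isWalk_iterate d n, ?_⟩
  rw [hn, Function.IsPeriodicPt, Function.IsFixedPt, Function.iterate_succ_apply'] at hper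
  exact hper.symm

theorem left_notMem_orbitList (hf : f.Involutive) (hm : m.Involutive) (hf_ne : ∀ d, f d ≠ d)
    (hm_ne : ∀ d, m d ≠ d) {d e : α} (h : e ∈ orbitList f m d) : f e ∉ orbitList f m d := by
  intro hfe
  obtain ⟨n, rfl⟩ := (mem_orbitList hf hm).1 h
  obtain ⟨k, hk⟩ := (mem_orbitList hf hm).1 hfe
  refine iterate_comp_ne_left hf hm hf_ne hm_ne (n + k) d ?_
  rw [Function.iterate_add_apply, hk, iterate_comp_left_iterate hf hm]

theorem exists_isTrace (hf : f.Involutive) (hm : m.Involutive) (hf_ne : ∀ d, f d ≠ d)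
    (hm_ne : ∀ d, m d ≠ d) : ∃ D, IsTrace f m D := by
  have : Finite (Loop f m) := Quot.finite _
  have := Fintype.ofFinite (Loop f m)
  let rep (c : Loop f m) : α := Function.surjInv loopOf_surjective c
  have loopOf_rep (c : Loop f m) : loopOf f m (rep c) = c := Function.surjInv_eq _ c
  let curve (c : Loop f m) : List α := orbitList f m (rep c)
  have hclosed (c : Loop f m) : IsClosedWalk f m (curve c) := isClosedWalk_orbitList hf hm _
  have hrep (c : Loop f m) : rep c ∈ curve c := self_mem_orbitList hf hm _
  have loopOf_eq {c : Loop f m} {d : α} (hd : d ∈ curve c) : loopOf f m d = c :=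
    ((hclosed c).loopOf_eq hd (hrep c)).trans (loopOf_rep c)
  have hmem {d : α} : d ∈ ((Finset.univ.toList.map curve).flatten) ↔ d ∈ curve (loopOf f m d) := by
    simp only [List.mem_flatten, List.mem_map, Finset.mem_toList, Finset.mem_univ, true_and,
      exists_exists_eq_and]
    exact ⟨fun ⟨c, hc⟩ => by rwa [loopOf_eq hc], fun hd => ⟨_, hd⟩⟩
  refine ⟨Finset.univ.toList.map curve, ?_, isHalf_of_forall hf ?_ ?_ ?_⟩
  · simp only [List.mem_map]
    rintro _ ⟨c, -, rfl⟩
    exact hclosed c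
  · refine List.nodup_flatten.2 ⟨?_, List.pairwise_map.2 ?_⟩
    · simp only [List.mem_map]
      rintro _ ⟨c, -, rfl⟩
      exact orbitList_nodup _
    · refine (Finset.nodup_toList _).imp fun hne d hd hd' => hne ?_
      rw [← loopOf_eq hd, loopOf_eq hd']
  · intro d hd
    rw [hmem] at hd
    rw [hmem, loopOf_left]
    exact left_notMem_orbitList hf hm hf_ne hm_ne hd
  · intro d
    rw [hmem, hmem, loopOf_left]
    exact (hclosed _).mem_or_left_mem_of_loopOf_eq hf hm (loopOf_rep _) (.inl (hrep _))

end Existence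

section StateSumFormula

variable {X : Type*} {f : MedialDart X → MedialDart X} {σ : X → Option Bool} {x : X}

/-- The number of closed curves of the state in which the edges in `S` are kept and the others are
cut. -/
noncomputable def stateLoops (f : MedialDart X → MedialDart X) (S : X → Bool) : ℕ :=
  numLoops f (mate fun e => some (S e))

theorem potential_of_forall_ne_none (hσ : ∀ e, σ e ≠ none) (D : List (List (MedialDart X)))
    (n : ℤ) : potential σ D n = (-2) ^ D.length * (2 * D.length + n) := by
  have hweight (w : List (MedialDart X)) : weight (crossSign σ) w = 0 := by
    induction w with
    | nil => rfl
    | cons a w ih => rw [weight_cons_of_null (crossSign_comm σ) (crossSign_of_ne_none (hσ _)), ih]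
  have htotal : totalWeight σ D = 0 :=
    List.sum_eq_zero (by simp only [List.mem_map]; rintro _ ⟨w, -, rfl⟩; exact hweight w)
  rw [potential, htotal, mul_zero, add_zero]

theorem card_crossings_update [Finite X] [DecidableEq X] (hx : σ x = none) {τ : Option Bool}
    (hτ : τ ≠ none) {n : ℕ} (hn : Nat.card {e // σ e = none} = n + 1) :
    Nat.card {e // Function.update σ x τ e = none} = n := by
  have herase : {e | Function.update σ x τ e = none} = {e | σ e = none} \ {x} := by
    ext e
    by_cases he : e = x
    · simp [he, hτ]
    · simp [he]
  have hcard := Set.ncard_sdiff_singleton_add_one (show x ∈ {e | σ e = none} from hx)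
    (Set.toFinite _)
  rw [← herase] at hcard
  exact Nat.succ_injective (hcard.trans hn)

variable [Fintype X]

open Classical in
/-- The ways to smooth all crossings of a state. -/
noncomputable def smoothings (σ : X → Option Bool) : Finset (X → Bool) :=
  {S | ∀ e, σ e = none ∨ σ e = some (S e)}

theorem smoothings_some (S : X → Bool) : smoothings (fun e => some (S e)) = {S} := by
  ext S'
  simp [smoothings, funext_iff, eq_comm]

theorem smoothings_update_some [DecidableEq X] (hx : σ x = none) (b : Bool) :
    smoothings (Function.update σ x (some b)) = {S ∈ smoothings σ | S x = b} := by
  ext S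
  simp only [smoothings, Finset.mem_filter, Finset.mem_univ, true_and]
  refine ⟨fun hS => ⟨fun e => ?_, by simpa [eq_comm] using hS x⟩, ?_⟩
  · by_cases he : e = x
    · exact .inl (he ▸ hx)
    · simpa [he] using hS e
  · rintro ⟨hS, rfl⟩ e
    by_cases he : e = x
    · simp [he]
    · simpa [he] using hS e

theorem sum_smoothings [DecidableEq X] (φ : (X → Bool) → ℤ) (hx : σ x = none) {τ τ' : Option Bool}
    (hτ : τ ≠ none) (hτ' : τ' ≠ none) (hne : τ ≠ τ') :
    ∑ S ∈ smoothings σ, φ S = ∑ S ∈ smoothings (Function.update σ x τ), φ S +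
      ∑ S ∈ smoothings (Function.update σ x τ'), φ S := by
  obtain ⟨b, rfl⟩ := Option.ne_none_iff_exists'.1 hτ
  obtain ⟨b', rfl⟩ := Option.ne_none_iff_exists'.1 hτ'
  have hb (S : X → Bool) : S x = b' ↔ ¬S x = b := by
    cases b <;> cases b' <;> simp_all
  simp only [smoothings_update_some hx, hb, Finset.sum_filter_add_sum_filter_not]

theorem IsTrace.state_sum (hf : f.Involutive) (hU : Unlinked f) {D : List (List (MedialDart X))}
    (h : IsTrace f (mate σ) D) {n : ℕ} (hn : Nat.card {e // σ e = none} = n) :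
    (-2 : ℤ) ^ D.length = (-1) ^ n * ∑ S ∈ smoothings σ, (-2) ^ stateLoops f S ∧
      potential σ D n =
        (-1) ^ n * ∑ S ∈ smoothings σ, (-2 : ℤ) ^ stateLoops f S * (2 * stateLoops f S) := by
  classical
  induction n generalizing σ D with
  | zero =>
    have hσ (e : X) : σ e ≠ none := fun he => (Finite.card_eq_zero_iff.1 hn).false ⟨e, he⟩
    choose S hS using fun e => Option.ne_none_iff_exists'.1 (hσ e)
    obtain rfl : σ = fun e => some (S e) := funext hS
    simp [smoothings_some, potential_of_forall_ne_none hσ, h.length_eq hf (mate_involutive _),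
      stateLoops]
  | succ n ih =>
    obtain ⟨⟨x, hx⟩⟩ : Nonempty {e // σ e = none} := (Nat.card_pos_iff.1 (by omega)).1
    obtain ⟨D₂, D₃, τ, τ', hτ, hτ', hne, h₂, h₃, hpow, hpotential⟩ := h.exists_smoothings hf hU hx
    obtain ⟨hpow₂, hpotential₂⟩ := ih h₂ (card_crossings_update hx hτ hn)
    obtain ⟨hpow₃, hpotential₃⟩ := ih h₃ (card_crossings_update hx hτ' hn)
    have hpotential_n := hpotential n
    rw [hpow₂, hpow₃] at hpow
    rw [hpotential₂, hpotential₃] at hpotential_n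
    rw [sum_smoothings _ hx hτ hτ' hne, sum_smoothings _ hx hτ hτ' hne, pow_succ]
    push_cast
    exact ⟨by linear_combination hpow, by linear_combination hpotential_n⟩

end StateSumFormula

section Heights

/-- The rotation around the vertices of the medial graph. -/
def medialRot {X : Type*} : MedialDart X → MedialDart X
  | (d, true) => (d, false)
  | (d, false) => ((d.1, !d.2), true)

variable {X : Type*} {f : MedialDart X → MedialDart X} {σ : X → Option Bool}
  {U : List (MedialDart X)}

theorem medialRot_fst_fst (c : MedialDart X) : (medialRot c).1.1 = c.1.1 := by
  rcases c with ⟨⟨e, s⟩, _ | _⟩ <;> rfl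

theorem mate_eq_medialRot_medialRot {c : MedialDart X} (hσ : σ c.1.1 = none) :
    mate σ c = medialRot (medialRot c) := by
  rcases c with ⟨⟨e, s⟩, _ | _⟩ <;> simp [mate, mateOf, medialRot, hσ]

theorem mate_eq_medialRot_or {c : MedialDart X} (hσ : σ c.1.1 ≠ none) :
    mate σ c = medialRot c ∨ medialRot (mate σ c) = c := by
  obtain ⟨b, hb⟩ := Option.ne_none_iff_exists'.1 hσ
  rcases c with ⟨⟨e, s⟩, _ | _⟩ <;> cases b <;> simp [mate, mateOf, medialRot, hb]

open Classical in
/-- The flow along a closed curve of the state `σ` with outgoing darts `U`, by the amount that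
leaves a medial vertex through a dart. -/
noncomputable def curveFlow (σ : X → Option Bool) (U : List (MedialDart X)) (a : MedialDart X) :
    ℚ :=
  U.count a - U.count (mate σ a)

theorem curveFlow_mate (a : MedialDart X) : curveFlow σ U (mate σ a) = -curveFlow σ U a := by
  rw [curveFlow, mate_mate, curveFlow, neg_sub]

theorem curveFlow_left (hf : f.Involutive) (hU : IsClosedWalk f (mate σ) U) (a : MedialDart X) :
    curveFlow σ U (f a) = -curveFlow σ U a := by
  classical
  simp only [curveFlow, ← hU.count_left hf (mate_involutive σ), hf a, neg_sub]

theorem sum_curveFlow_eq_zero (a : MedialDart X) :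
    curveFlow σ U a + curveFlow σ U (medialRot a) + curveFlow σ U (medialRot (medialRot a)) +
      curveFlow σ U (medialRot (medialRot (medialRot a))) = 0 := by
  rcases a with ⟨⟨e, s⟩, t⟩
  cases s <;> cases t <;> rcases hσ : σ e with _ | _ | _ <;>
    simp [curveFlow, medialRot, mate, mateOf, hσ] <;> ring

open Classical in
theorem crossSign_eq_indicator {b : MedialDart X} (hσ : σ b.1.1 = none) (u : MedialDart X) :
    crossSign σ u b = (if u = medialRot b then 1 else 0) +
      -if u = medialRot (medialRot (medialRot b)) then 1 else 0 := by
  rcases u with ⟨⟨e, s⟩, t⟩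
  rcases b with ⟨⟨e', s'⟩, t'⟩
  by_cases he : e = e'
  · subst he
    rw [crossSign, if_pos ⟨rfl, hσ⟩]
    cases s <;> cases t <;> cases s' <;> cases t' <;> simp [medialRot, endSign]
  · rw [crossSign_of_vertex_ne he]
    cases t' <;> simp [medialRot, he]

theorem sum_crossSign_eq_curveFlow {b : MedialDart X} (hσ : σ b.1.1 = none) :
    ((U.map fun u => crossSign σ u b).sum : ℚ) = curveFlow σ U (medialRot b) := by
  classical
  have sum_indicator (x : MedialDart X) :
      (U.map fun u => if u = x then (1 : ℤ) else 0).sum = U.count x := by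
    rw [List.sum_map_eq_nsmul_single x _ fun a ha _ => if_neg ha, if_pos rfl, nsmul_one]
    congr!
  have hmate : mate σ (medialRot b) = medialRot (medialRot (medialRot b)) :=
    mate_eq_medialRot_medialRot (by rwa [medialRot_fst_fst])
  simp only [crossSign_eq_indicator hσ, List.sum_map_add, sum_map_neg, sum_indicator,
    curveFlow, hmate]
  push_cast
  ring

theorem sum_crossSign_eq_zero {b : MedialDart X} (hσ : σ b.1.1 ≠ none) :
    (U.map fun u => crossSign σ u b).sum = 0 := by
  simp [crossSign_comm σ b, crossSign_of_ne_none hσ]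

/-- The property that every flow on the medial graph is the difference of a height function
on the faces; the height of a dart is the one of the face to its right. -/
def HasHeights (f : MedialDart X → MedialDart X) : Prop :=
  ∀ m : MedialDart X → ℚ, (∀ a, m (f a) = -m a) →
    (∀ a, m a + m (medialRot a) + m (medialRot (medialRot a)) +
      m (medialRot (medialRot (medialRot a))) = 0) →
    ∃ h : MedialDart X → ℚ, (∀ a, h (f a) = h a + m a) ∧ ∀ a, h (medialRot a) = h a + m a

theorem height_mate {h : MedialDart X → ℚ} (hh : ∀ a, h (medialRot a) = h a + curveFlow σ U a)
    {c : MedialDart X} (hc : curveFlow σ U c = 0) :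
    h (mate σ c) = h c - (U.map fun u => crossSign σ u (mate σ c)).sum := by
  by_cases hσ : σ c.1.1 = none
  · have hflow : curveFlow σ U (medialRot (mate σ c)) = -curveFlow σ U (medialRot c) := by
      rw [← curveFlow_mate, mate_eq_medialRot_medialRot hσ,
        mate_eq_medialRot_medialRot (by rwa [medialRot_fst_fst])]
    rw [sum_crossSign_eq_curveFlow (by rwa [mate_fst_fst]), hflow,
      mate_eq_medialRot_medialRot hσ, hh, hh, hc]
    ring
  · rw [sum_crossSign_eq_zero (by rwa [mate_fst_fst]), Int.cast_zero, sub_zero]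
    rcases mate_eq_medialRot_or hσ with hmate | hmate
    · rw [hmate, hh, hc, add_zero]
    · have hheight := hh (mate σ c)
      rwa [hmate, curveFlow_mate, hc, neg_zero, add_zero, eq_comm] at hheight

section Potential

variable {α G : Type*} [AddCommGroup G] {f m : α → α} {w : List α} {h g : α → G}

theorem IsWalk.exists_left_eq {p z : α} (hw : IsWalk f m p w z)
    (hh : ∀ a ∈ p :: w, h (m (f a)) = h a - g (m (f a))) :
    ∃ l ∈ p :: w, f l = z ∧ h l = h p - (w.map g).sum := by
  induction w generalizing p with
  | nil => exact ⟨p, by simp, hw, by simp⟩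
  | cons b w ih =>
    obtain ⟨rfl, hw⟩ := hw
    obtain ⟨l, hl, hlz, hheight⟩ := ih hw fun a ha => hh a (.tail _ ha)
    refine ⟨l, .tail _ hl, hlz, ?_⟩
    rw [hheight, hh p (.head _), List.map_cons, List.sum_cons, sub_sub]

theorem IsClosedWalk.sum_eq_zero (hw : IsClosedWalk f m w)
    (hh : ∀ a ∈ w, h (m (f a)) = h a - g (m (f a))) : (w.map g).sum = 0 := by
  cases w with
  | nil => rfl
  | cons p w =>
    obtain ⟨z, hw, rfl⟩ := hw
    obtain ⟨l, hl, rfl, hheight⟩ := hw.exists_left_eq hh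
    have hlast := hh l hl
    rw [hheight, sub_sub, eq_comm, sub_eq_self] at hlast
    rw [List.map_cons, List.sum_cons, add_comm, hlast]

end Potential

-- The height function of the flow along `U` shows that `V` crosses `U` from either side equally
-- often.
theorem unlinked_of_hasHeights (hf : f.Involutive) (hheights : HasHeights f) : Unlinked f := by
  classical
  intro σ U V D hD
  have hU : IsClosedWalk f (mate σ) U := hD.closed U (.head _)
  have hV : IsClosedWalk f (mate σ) V := hD.closed V (.tail _ (.head _))
  have hdisjoint : U.Disjoint (V :: D).flatten := (List.nodup_append'.1 hD.half.nodup).2.2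
  have curveFlow_eq_zero {a : MedialDart X} (ha : a ∈ V) : curveFlow σ U a = 0 := by
    have hfa : f a ∉ U := fun hfa => hD.half.notMem (d := a) (by simp [ha]) (by simp [hfa])
    rw [hU.left_mem_iff hf (mate_involutive σ)] at hfa
    rw [curveFlow,
      List.count_eq_zero_of_not_mem fun haU => hdisjoint haU (List.mem_append_left _ ha),
      List.count_eq_zero_of_not_mem hfa, sub_self]
  obtain ⟨h, hh_left, hh_rot⟩ :=
    hheights (curveFlow σ U) (curveFlow_left hf hU) sum_curveFlow_eq_zero
  have hsum := hV.sum_eq_zero (h := h) (g := fun b => ((U.map fun u => crossSign σ u b).sum : ℚ))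
    fun a ha => by
      rw [height_mate hh_rot (by rw [curveFlow_left hf hU, curveFlow_eq_zero ha, neg_zero]),
        hh_left, curveFlow_eq_zero ha, add_zero]
  rw [crossSum, sum_map_sum_map_comm]
  have hcast := Int.cast_list_sum (R := ℚ) (V.map fun b => (U.map fun u => crossSign σ u b).sum)
  rw [List.map_map] at hcast
  exact_mod_cast hcast.trans hsum

end Heights

section Euler

variable {V E : Type*} {G : Graph V E}

theorem isConnected_induction (hG : G.IsConnected) {Q : V → Prop} {x : V}
    (hx : x ∈ G.vertexSet) (hQ : Q x) (h : ∀ e a b, G.IsLink e a b → Q a → Q b) :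
    ∀ y ∈ G.vertexSet, Q y := by
  intro y hy
  induction hG.2 x hx y hy with
  | refl => exact hQ
  | tail _ hadj ih =>
    obtain ⟨e, he⟩ := hadj
    exact h e _ _ he (ih he.left_mem)

theorem card_le_finrank_add_one {ι K : Type*} [Fintype ι] [DecidableEq ι] [Field K]
    (W : Submodule K (ι → K)) (hW : ∀ i j, Pi.single i 1 - Pi.single j 1 ∈ W) :
    Fintype.card ι ≤ Module.finrank K W + 1 := by
  rcases isEmpty_or_nonempty ι with hι | ⟨⟨j⟩⟩
  · simp
  let L : Submodule K (ι → K) := Submodule.span K {Pi.single j 1}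
  have htop : W ⊔ L = ⊤ := by
    refine eq_top_iff.2 ((Pi.basisFun K ι).span_eq.symm.trans_le (Submodule.span_le.2 ?_))
    rintro _ ⟨i, rfl⟩
    rw [Pi.basisFun_apply, ← sub_add_cancel (Pi.single i 1) (Pi.single j 1)]
    exact add_mem (Submodule.mem_sup_left (hW i j))
      (Submodule.mem_sup_right (Submodule.mem_span_singleton_self _))
  have hL : Module.finrank K L ≤ 1 := (finrank_span_le_card _).trans (by simp)
  calc
    Fintype.card ι = Module.finrank K (W ⊔ L : Submodule K (ι → K)) := by
      rw [htop, finrank_top, Module.finrank_fintype_fun_eq_card]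
    _ ≤ Module.finrank K W + Module.finrank K L := Submodule.finrank_add_le_finrank_add_finrank W L
    _ ≤ Module.finrank K W + 1 := Nat.add_le_add_left hL _

namespace PlanarEmbedding

variable (P : PlanarEmbedding G)

theorem base_mem (d : G.edgeSet × Bool) : P.base d ∈ G.vertexSet := by
  rcases d with ⟨e, _ | _⟩
  · exact (P.isLink e).left_mem
  · exact (P.isLink e).right_mem

theorem isLink_base (d : G.edgeSet × Bool) : G.IsLink d.1 (P.base d) (P.base (d.1, !d.2)) := by
  rcases d with ⟨e, _ | _⟩
  · exact P.isLink e
  · exact (P.isLink e).symm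

theorem exists_base_of_isLink {e : E} {a b : V} (h : G.IsLink e a b) :
    ∃ d : G.edgeSet × Bool, d.1.1 = e ∧ P.base d = a ∧ P.base (d.1, !d.2) = b := by
  rcases h.eq_and_eq_or_eq_and_eq (P.isLink ⟨e, h.edge_mem⟩) with ⟨ha, hb⟩ | ⟨ha, hb⟩
  · exact ⟨(⟨e, h.edge_mem⟩, false), rfl, ha.symm, hb.symm⟩
  · exact ⟨(⟨e, h.edge_mem⟩, true), rfl, ha.symm, hb.symm⟩

theorem base_rot (d : G.edgeSet × Bool) : P.base (P.rot d) = P.base d :=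
  ((P.sameCycle_iff _ _).1 (Equiv.Perm.sameCycle_apply_right.2 (.refl _ _))).symm

/-- The vertex at which an edge end lies. -/
def vertexOf (d : G.edgeSet × Bool) : G.vertexSet := ⟨P.base d, P.base_mem d⟩

theorem vertexOf_rot (d : G.edgeSet × Bool) : P.vertexOf (P.rot d) = P.vertexOf d :=
  Subtype.ext (P.base_rot d)

theorem vertexOf_rot_symm (d : G.edgeSet × Bool) :
    P.vertexOf (P.rot.symm d) = P.vertexOf d := by
  rw [← vertexOf_rot, Equiv.apply_symm_apply]

/-- The face to the left of an edge end, for an observer who walks away from its vertex. -/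
def leftFace (d : G.edgeSet × Bool) : P.toMap.Face :=
  Quotient.mk (Equiv.Perm.SameCycle.setoid P.toMap.faceStep) (d.1, !d.2)

theorem leftFace_rot_symm (d : G.edgeSet × Bool) :
    P.leftFace (P.rot.symm d) = P.leftFace (d.1, !d.2) := by
  have hstep : P.toMap.faceStep ((P.rot.symm d).1, !(P.rot.symm d).2) = (d.1, !!d.2) := by
    simp [CombMap.faceStep, toMap, swapEnds]
  rw [leftFace, leftFace, ← hstep]
  exact Quotient.sound (Equiv.Perm.sameCycle_apply_right.2 (.refl _ _))

/-- The difference of a function on the vertices and a function on the faces, at the corners. The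
corner between `d` and `rot d` is denoted by `d`. -/
def cornerDiff : (G.vertexSet → ℚ) × (P.toMap.Face → ℚ) →ₗ[ℚ] (G.edgeSet × Bool → ℚ) :=
  (LinearMap.funLeft ℚ ℚ P.vertexOf).coprod (-LinearMap.funLeft ℚ ℚ P.leftFace)

theorem cornerDiff_apply (a : G.vertexSet → ℚ) (b : P.toMap.Face → ℚ) (d : G.edgeSet × Bool) :
    P.cornerDiff (a, b) d = a (P.vertexOf d) - b (P.leftFace d) := by
  simp [cornerDiff, sub_eq_add_neg]

/-- The total flow out of the medial vertices, for a flow along the medial edges, which lie at the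
corners. -/
def cornerFlow : (G.edgeSet × Bool → ℚ) →ₗ[ℚ] (G.edgeSet → ℚ) where
  toFun m e := m (e, true) - m (P.rot.symm (e, true)) + m (e, false) - m (P.rot.symm (e, false))
  map_add' a b := by
    funext e
    simp only [Pi.add_apply]
    ring
  map_smul' c a := by
    funext e
    simp only [Pi.smul_apply, smul_eq_mul, RingHom.id_apply]
    ring

theorem cornerFlow_apply (m : G.edgeSet × Bool → ℚ) (e : G.edgeSet) :
    P.cornerFlow m e =
      m (e, true) - m (P.rot.symm (e, true)) + m (e, false) - m (P.rot.symm (e, false)) := rfl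

theorem range_cornerDiff_le : LinearMap.range P.cornerDiff ≤ LinearMap.ker P.cornerFlow := by
  rintro _ ⟨⟨a, b⟩, rfl⟩
  rw [LinearMap.mem_ker]
  funext e
  simp [cornerFlow_apply, cornerDiff_apply, vertexOf_rot_symm, leftFace_rot_symm]

theorem eq_zero_of_cornerDiff_eq_zero (hG : G.IsConnected) {a : G.vertexSet → ℚ}
    {b : P.toMap.Face → ℚ} (hab : P.cornerDiff (a, b) = 0) {x : G.vertexSet} (hx : a x = 0) :
    (a, b) = 0 := by
  have hcorner (d : G.edgeSet × Bool) : a (P.vertexOf d) = b (P.leftFace d) := by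
    rw [← sub_eq_zero, ← cornerDiff_apply, hab, Pi.zero_apply]
  have hflip (d : G.edgeSet × Bool) : a (P.vertexOf (d.1, !d.2)) = a (P.vertexOf d) := by
    rw [hcorner, ← leftFace_rot_symm, ← hcorner, vertexOf_rot_symm]
  have ha : ∀ y ∈ G.vertexSet, ∀ hy : y ∈ G.vertexSet, a ⟨y, hy⟩ = 0 := by
    refine isConnected_induction hG x.2 (fun _ => hx) fun e y z he hy hz => ?_
    obtain ⟨d, rfl, rfl, rfl⟩ := P.exists_base_of_isLink he
    exact (hflip d).trans (hy (P.base_mem d))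
  refine Prod.ext (funext fun y => ha y y.2 y.2) (funext fun φ => ?_)
  induction φ using Quotient.ind with | _ d =>
  have hface : P.leftFace (d.1, !d.2) = ⟦d⟧ := by
    rw [leftFace, Bool.not_not]
  change b ⟦d⟧ = 0
  rw [← hface, ← hcorner]
  exact ha _ (P.base_mem _) (P.base_mem _)

theorem finrank_ker_cornerDiff_le (hG : G.IsConnected) :
    Module.finrank ℚ (LinearMap.ker P.cornerDiff) ≤ 1 := by
  obtain ⟨x, hx⟩ := hG.1
  let evalVertex : LinearMap.ker P.cornerDiff →ₗ[ℚ] ℚ :=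
    (LinearMap.proj ⟨x, hx⟩ ∘ₗ LinearMap.fst ℚ (G.vertexSet → ℚ) (P.toMap.Face → ℚ)) ∘ₗ
      (LinearMap.ker P.cornerDiff).subtype
  have hinj : Function.Injective evalVertex := by
    rw [← LinearMap.ker_eq_bot, LinearMap.ker_eq_bot']
    rintro ⟨⟨a, b⟩, hab⟩ hax
    exact Subtype.ext (P.eq_zero_of_cornerDiff_eq_zero hG hab hax)
  simpa using LinearMap.finrank_le_finrank_of_injective hinj

section CornerFlow

variable [DecidableEq G.edgeSet]

theorem cornerFlow_single (d : G.edgeSet × Bool) :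
    P.cornerFlow (Pi.single d 1) = Pi.single d.1 1 - Pi.single (P.rot d).1 1 := by
  have sum_ends (c : G.edgeSet × Bool) (e : G.edgeSet) :
      (if (e, true) = c then (1 : ℚ) else 0) + (if (e, false) = c then 1 else 0) =
        if e = c.1 then 1 else 0 := by
    rcases c with ⟨e', _ | _⟩ <;> simp
  funext e
  simp only [cornerFlow_apply, Pi.sub_apply, Pi.single_apply, P.rot.symm_apply_eq, ← sum_ends]
  ring

theorem single_sub_single_mem_of_base_eq [Finite G.edgeSet] {d c : G.edgeSet × Bool}
    (h : P.base d = P.base c) :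
    Pi.single d.1 1 - Pi.single c.1 1 ∈ LinearMap.range P.cornerFlow := by
  have hrot (d : G.edgeSet × Bool) :
      Pi.single d.1 1 - Pi.single (P.rot d).1 1 ∈ LinearMap.range P.cornerFlow :=
    ⟨_, P.cornerFlow_single d⟩
  obtain ⟨n, rfl⟩ := ((P.sameCycle_iff d c).2 h).exists_nat_pow_eq
  clear h
  induction n with
  | zero => simp
  | succ n ih =>
    rw [pow_succ', Equiv.Perm.mul_apply, ← sub_add_sub_cancel _ (Pi.single ((P.rot ^ n) d).1 1)]
    exact add_mem ih (hrot _)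

theorem single_sub_single_mem [Finite G.edgeSet] (hG : G.IsConnected) (e e' : G.edgeSet) :
    Pi.single e 1 - Pi.single e' 1 ∈ LinearMap.range P.cornerFlow := by
  have hvertex : ∀ y ∈ G.vertexSet, ∃ d, P.base d = y ∧
      Pi.single d.1 1 - Pi.single e' 1 ∈ LinearMap.range P.cornerFlow := by
    refine isConnected_induction hG (P.base_mem (e', true)) ⟨(e', true), rfl, by simp⟩ ?_
    rintro e a b he ⟨d, rfl, hd⟩
    obtain ⟨c, rfl, hc, rfl⟩ := P.exists_base_of_isLink he
    refine ⟨(c.1, !c.2), rfl, ?_⟩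
    rw [← sub_add_sub_cancel _ (Pi.single d.1 1)]
    exact add_mem (P.single_sub_single_mem_of_base_eq (d := c) hc) hd
  obtain ⟨d, hd, hmem⟩ := hvertex _ (P.base_mem (e, true))
  rw [← sub_add_sub_cancel _ (Pi.single d.1 1)]
  exact add_mem (P.single_sub_single_mem_of_base_eq (d := (e, true)) hd.symm) hmem

end CornerFlow

theorem range_cornerDiff [Finite G.edgeSet] (hV : G.vertexSet.Finite) (hG : G.IsConnected)
    [Nonempty G.edgeSet] : LinearMap.range P.cornerDiff = LinearMap.ker P.cornerFlow := by
  classical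
  have := Fintype.ofFinite G.edgeSet
  have := hV.fintype
  have : Finite P.toMap.Face := Quotient.finite _
  have := Fintype.ofFinite P.toMap.Face
  refine Submodule.eq_of_le_of_finrank_le P.range_cornerDiff_le ?_
  have hdiff := P.cornerDiff.finrank_range_add_finrank_ker
  have hflow := P.cornerFlow.finrank_range_add_finrank_ker
  have hker := P.finrank_ker_cornerDiff_le hG
  have hrange := card_le_finrank_add_one _ (P.single_sub_single_mem hG)
  have heuler : G.vertexSet.ncard + P.toMap.numFaces = G.edgeSet.ncard + 2 := P.euler
  rw [CombMap.numFaces, if_neg (by simp), ← Nat.card_coe_set_eq, ← Nat.card_coe_set_eq,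
    Nat.card_eq_fintype_card, Nat.card_eq_fintype_card, Nat.card_eq_fintype_card] at heuler
  rw [Module.finrank_prod, Module.finrank_fintype_fun_eq_card,
    Module.finrank_fintype_fun_eq_card] at hdiff
  rw [Module.finrank_fintype_fun_eq_card, Fintype.card_prod, Fintype.card_bool] at hflow
  omega

theorem medial_flip_involutive : Function.Involutive P.medial.flip := P.medial.flip_flip

theorem medial_flip_true (d : G.edgeSet × Bool) : P.medial.flip (d, true) = (P.rot d, false) := rfl

theorem medial_flip_false (d : G.edgeSet × Bool) :
    P.medial.flip (d, false) = (P.rot.symm d, true) := rfl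

theorem hasHeights [Finite G.edgeSet] (hV : G.vertexSet.Finite) (hG : G.IsConnected)
    [Nonempty G.edgeSet] : HasHeights P.medial.flip := by
  intro m hflip hrot
  have hm (d : G.edgeSet × Bool) : m (d, false) = -m (P.rot.symm d, true) := by
    rw [← medial_flip_false, hflip, neg_neg]
  have hker : (fun d => m (d, true)) ∈ LinearMap.ker P.cornerFlow := by
    rw [LinearMap.mem_ker]
    funext e
    have hsum := hrot ((e, true), true)
    simp only [medialRot, hm, Bool.not_true] at hsum
    rw [cornerFlow_apply, Pi.zero_apply]
    linear_combination hsum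
  rw [← P.range_cornerDiff hV hG] at hker
  obtain ⟨⟨a, b⟩, hab⟩ := hker
  have hdiff (d : G.edgeSet × Bool) : m (d, true) = a (P.vertexOf d) - b (P.leftFace d) := by
    rw [← cornerDiff_apply, hab]
  refine ⟨fun d => if d.2 then b (P.leftFace d.1) else a (P.vertexOf d.1), ?_, ?_⟩
  · rintro ⟨d, _ | _⟩
    · simp [medial_flip_false, hm, hdiff, vertexOf_rot_symm]
    · simp [medial_flip_true, hdiff, vertexOf_rot]
  · rintro ⟨d, _ | _⟩
    · simp [medialRot, hm, hdiff, vertexOf_rot_symm, leftFace_rot_symm]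
    · simp [medialRot, hdiff]

theorem unlinked [Finite G.edgeSet] (hV : G.vertexSet.Finite) (hG : G.IsConnected)
    [Nonempty G.edgeSet] : Unlinked P.medial.flip :=
  unlinked_of_hasHeights P.medial_flip_involutive (P.hasHeights hV hG)

end PlanarEmbedding

end Euler

section StateLoops

variable {X : Type*} [Finite X] [DecidableEq X] {f : MedialDart X → MedialDart X}

theorem stateLoops_update_true (hf : f.Involutive) (hf_ne : ∀ d, f d ≠ d) (hU : Unlinked f)
    {S : X → Bool} {x : X} (hS : S x = false) :
    stateLoops f (Function.update S x true) + 1 = stateLoops f S ∨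
      stateLoops f (Function.update S x true) ≤ stateLoops f S + 1 ∧
        ∃ t t', loopOf f (mate fun e => some (S e)) ((x, false), t) =
          loopOf f (mate fun e => some (S e)) ((x, true), t') := by
  have hupdate : Function.update (fun e => some (S e)) x (some true) =
      fun e => some (Function.update S x true e) :=
    funext fun e => (Function.apply_update (fun _ => some) S x true e).symm
  have stateLoops_eq_length {D : List (List (MedialDart X))}
      (h : IsTrace f (mate (Function.update (fun e => some (S e)) x (some true))) D) :
      stateLoops f (Function.update S x true) = D.length := by
    rw [stateLoops, ← hupdate, h.length_eq hf (mate_involutive _)]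
  have eq_some_true : ∀ τ τ' : Option Bool, some false ≠ τ → some false ≠ τ' → τ ≠ τ' →
      τ = some true ∨ τ' = some true := by decide
  obtain ⟨D, hD⟩ := exists_isTrace hf (mate_involutive fun e => some (S e)) hf_ne (mate_ne _)
  rw [stateLoops.eq_1 f S, ← hD.length_eq hf (mate_involutive _)]
  obtain ⟨D₁, p, u, q, v, D', rfl, hq, h₁, hlen, -, rfl | rfl⟩ := hD.exists_strands hf hU x
  · obtain ⟨z, τj, τr, hr⟩ := h₁.exists_isResolution_of_split hf hq.symm
    left
    rcases eq_some_true τj τr (hS ▸ hr.split_ne_join) (hS ▸ hr.split_ne_joinReverse)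
      hr.join_ne_joinReverse with rfl | rfl
    · rw [stateLoops_eq_length hr.join, hlen, List.length_cons, List.length_cons, List.length_cons]
    · rw [stateLoops_eq_length hr.joinReverse, hlen, List.length_cons, List.length_cons,
        List.length_cons]
  · obtain ⟨z, τs, τr, hr⟩ := h₁.exists_isResolution_of_join hf hq.symm
    right
    constructor
    · rcases eq_some_true τs τr (hS ▸ hr.split_ne_join.symm) (hS ▸ hr.join_ne_joinReverse)
        hr.split_ne_joinReverse with rfl | rfl
      · rw [stateLoops_eq_length hr.split, hlen, List.length_cons, List.length_cons,
          List.length_cons]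
      · rw [stateLoops_eq_length hr.joinReverse, hlen, List.length_cons, List.length_cons]
        exact Nat.le_succ _
    · have hloop := (h₁.closed _ (.head _)).loopOf_eq (a := p) (b := q) (by simp) (by simp)
      have hends : q.1.2 = !p.1.2 := Bool.eq_not.2
        (h₁.fst_snd_ne_of_cut (by simp) (by simp) hq.symm (by rw [hS]) hr.ne).symm
      obtain ⟨⟨e, s⟩, t⟩ := p
      obtain ⟨⟨_, _⟩, t'⟩ := q
      obtain rfl : _ = e := hq
      obtain rfl : _ = !s := hends
      cases s
      · exact ⟨t, t', hloop⟩
      · exact ⟨t', t, hloop.symm⟩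

end StateLoops

section SpanningSubgraphs

variable {V E : Type*} {G : Graph V E}

/-- Two vertices are related if they are joined by an edge in `S`. -/
def JoinedBy (G : Graph V E) (S : G.edgeSet → Bool) (x y : G.vertexSet) : Prop :=
  ∃ e : G.edgeSet, S e = true ∧ G.IsLink e x y

/-- The connected components of the spanning subgraph with edge set `S`. -/
def Component (G : Graph V E) (S : G.edgeSet → Bool) : Type _ := Quot (JoinedBy G S)

/-- The number of connected components of the spanning subgraph with edge set `S`. -/
noncomputable def numComponents (G : Graph V E) (S : G.edgeSet → Bool) : ℕ :=
  Nat.card (Component G S)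

/-- The connected component of a vertex in the spanning subgraph with edge set `S`. -/
def componentOf (S : G.edgeSet → Bool) (v : G.vertexSet) : Component G S := Quot.mk _ v

theorem componentOf_surjective (S : G.edgeSet → Bool) :
    Function.Surjective (componentOf S) := Quot.mk_surjective

theorem componentOf_eq_of_isLink {S : G.edgeSet → Bool} {e : G.edgeSet} (he : S e = true)
    {v w : G.vertexSet} (h : G.IsLink e v w) : componentOf S v = componentOf S w :=
  Quot.sound ⟨e, he, h⟩

instance [Finite G.vertexSet] (S : G.edgeSet → Bool) : Finite (Component G S) := Quot.finite _

theorem componentOf_injective_of_empty :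
    Function.Injective (componentOf fun _ : G.edgeSet => false) := by
  let vertex : Component G (fun _ => false) → G.vertexSet :=
    Quot.lift id (by rintro v w ⟨e, he, -⟩; cases he)
  exact Function.LeftInverse.injective (g := vertex) fun _ => rfl

theorem numComponents_empty : numComponents G (fun _ => false) = G.vertexSet.ncard := by
  rw [← Nat.card_coe_set_eq]
  exact (Nat.card_eq_of_bijective _
    ⟨componentOf_injective_of_empty, componentOf_surjective _⟩).symm

theorem numComponents_univ_le_one (hG : G.IsConnected) :
    numComponents G (fun _ => true) ≤ 1 := by
  obtain ⟨x, hx⟩ := hG.1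
  have componentOf_eq : ∀ y ∈ G.vertexSet, ∀ hy : y ∈ G.vertexSet,
      componentOf (fun _ => true) ⟨y, hy⟩ = componentOf (fun _ => true) ⟨x, hx⟩ :=
    isConnected_induction hG hx (fun _ => rfl) fun e y z he ih hz =>
      (componentOf_eq_of_isLink (e := ⟨e, he.edge_mem⟩) rfl he.symm).trans (ih he.left_mem)
  have : Subsingleton (Component G fun _ => true) := subsingleton_of_forall_eq
    (componentOf _ ⟨x, hx⟩) fun c => by
      obtain ⟨y, rfl⟩ := componentOf_surjective _ c
      exact componentOf_eq y y.2 y.2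
  exact Finite.card_le_one_iff_subsingleton.2 this

section Update

variable [DecidableEq G.edgeSet] {S : G.edgeSet → Bool} {x : G.edgeSet} {v w : G.vertexSet}

theorem exists_component_map_of_update {α : Type*} (hx : G.IsLink x v w)
    (φ : Component G S → α) (hφ : φ (componentOf S v) = φ (componentOf S w)) :
    ∃ ψ : Component G (Function.update S x true) → α,
      ∀ y, ψ (componentOf _ y) = φ (componentOf S y) := by
  refine ⟨Quot.lift (fun y => φ (componentOf S y)) ?_, fun _ => rfl⟩
  rintro y z ⟨e, he, hyz⟩
  by_cases hex : e = x
  · subst hex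
    rcases hyz.eq_and_eq_or_eq_and_eq hx with ⟨hy, hz⟩ | ⟨hy, hz⟩
    · rwa [Subtype.ext hy, Subtype.ext hz]
    · rw [Subtype.ext hy, Subtype.ext hz, hφ]
  · rw [Function.update_of_ne hex] at he
    rw [componentOf_eq_of_isLink he hyz]

variable [Finite G.vertexSet]

theorem numComponents_le_update_of_eq (hx : G.IsLink x v w)
    (h : componentOf S v = componentOf S w) :
    numComponents G S ≤ numComponents G (Function.update S x true) := by
  obtain ⟨ψ, hψ⟩ := exists_component_map_of_update hx id h
  refine Nat.card_le_card_of_surjective ψ fun c => ?_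
  obtain ⟨y, rfl⟩ := componentOf_surjective S c
  exact ⟨_, hψ y⟩

theorem numComponents_le_update_add_one (hx : G.IsLink x v w) :
    numComponents G S ≤ numComponents G (Function.update S x true) + 1 := by
  classical
  obtain ⟨ψ, hψ⟩ := exists_component_map_of_update hx
    (Function.update id (componentOf S w) (componentOf S v)) (by
      simp only [Function.update_self, Function.update_apply, id_eq, ite_self])
  have hsurj : Function.Surjective fun o : Option (Component G (Function.update S x true)) =>
      o.elim (componentOf S w) ψ := fun c => by
    obtain ⟨y, rfl⟩ := componentOf_surjective S c
    by_cases hy : componentOf S y = componentOf S w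
    · exact ⟨none, hy.symm⟩
    · exact ⟨some (componentOf _ y), (hψ y).trans (Function.update_of_ne hy _ _)⟩
  have hcard := Nat.card_le_card_of_surjective _ hsurj
  rwa [Finite.card_option] at hcard

end Update

namespace PlanarEmbedding

variable (P : PlanarEmbedding G)

theorem componentOf_vertexOf {S : G.edgeSet → Bool} {d : G.edgeSet × Bool} (hd : S d.1 = true) :
    componentOf S (P.vertexOf (d.1, !d.2)) = componentOf S (P.vertexOf d) :=
  (componentOf_eq_of_isLink hd (P.isLink_base d)).symm

/-- The component of the spanning subgraph that a curve of the smoothed state surrounds. -/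
def componentOfLoop (S : G.edgeSet → Bool) :
    Loop P.medial.flip (mate fun e => some (S e)) → Component G S :=
  Quot.lift (fun d => componentOf S (P.vertexOf d.1)) (by
    rintro ⟨d, t⟩ _ (rfl | rfl)
    · cases t
      · rw [medial_flip_false, vertexOf_rot_symm]
      · rw [medial_flip_true, vertexOf_rot]
    · rcases hS : S d.1 with _ | _
      · simp only [mate, mateOf, hS]
      · simp only [mate, mateOf, hS]
        exact (P.componentOf_vertexOf hS).symm)

section EmptySubgraph

theorem loopOf_empty_snd (d : G.edgeSet × Bool) (t t' : Bool) :
    loopOf P.medial.flip (mate fun _ => some false) (d, t) =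
      loopOf P.medial.flip (mate fun _ => some false) (d, t') := by
  rcases Bool.eq_or_eq_not t t' with rfl | rfl
  · rfl
  · exact loopOf_right (m := mate fun _ => some false) (d, t')

theorem loopOf_empty_rot (d : G.edgeSet × Bool) (t : Bool) :
    loopOf P.medial.flip (mate fun _ => some false) (P.rot d, t) =
      loopOf P.medial.flip (mate fun _ => some false) (d, t) := by
  rw [P.loopOf_empty_snd _ t false, P.loopOf_empty_snd d t true, ← medial_flip_true, loopOf_left]

theorem componentOfLoop_empty_injective [Finite G.edgeSet] :
    Function.Injective (P.componentOfLoop fun _ => false) := by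
  intro α β hαβ
  obtain ⟨⟨a, t⟩, rfl⟩ := loopOf_surjective α
  obtain ⟨⟨b, t'⟩, rfl⟩ := loopOf_surjective β
  have hbase : P.base a = P.base b := congrArg Subtype.val (componentOf_injective_of_empty hαβ)
  obtain ⟨n, rfl⟩ := ((P.sameCycle_iff _ _).2 hbase).exists_nat_pow_eq
  rw [P.loopOf_empty_snd a t t']
  clear hαβ hbase
  induction n with
  | zero => rfl
  | succ n ih => rw [ih, pow_succ', Equiv.Perm.mul_apply, loopOf_empty_rot]

end EmptySubgraph

theorem leftFace_flip_rot_symm (d : G.edgeSet × Bool) :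
    P.leftFace (P.rot.symm (d.1, !d.2)) = P.leftFace d := by
  rw [leftFace_rot_symm, Bool.not_not]

/-- The face that a curve surrounds when all edges are kept. -/
def faceOfLoop : Loop P.medial.flip (mate fun _ => some true) → P.toMap.Face :=
  Quot.lift (fun d => P.leftFace (if d.2 then d.1 else P.rot.symm d.1)) (by
    rintro ⟨d, _ | _⟩ _ (rfl | rfl)
    · rfl
    · exact P.leftFace_rot_symm d
    · exact congrArg P.leftFace (P.rot.symm_apply_apply d).symm
    · exact (P.leftFace_flip_rot_symm d).symm)

theorem faceOfLoop_surjective : Function.Surjective P.faceOfLoop := by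
  intro φ
  induction φ using Quotient.ind with | _ d =>
  refine ⟨loopOf _ _ ((d.1, !d.2), true), ?_⟩
  change P.leftFace (d.1, !d.2) = _
  rw [leftFace, Bool.not_not]

theorem numFaces_le_stateLoops [Finite G.edgeSet] [Nonempty G.edgeSet] :
    P.toMap.numFaces ≤ stateLoops P.medial.flip fun _ => true := by
  have : Finite (Loop P.medial.flip (mate fun _ => some true)) := Quot.finite _
  rw [CombMap.numFaces, if_neg (by simp)]
  exact Nat.card_le_card_of_surjective _ P.faceOfLoop_surjective

variable [Fintype G.edgeSet]

/-- The amount by which the number of curves of a smoothed state falls short of its value for a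
plane graph. -/
noncomputable def genusDefect (S : G.edgeSet → Bool) : ℤ :=
  2 * numComponents G S + Finset.card {e | S e = true} - G.vertexSet.ncard -
    stateLoops P.medial.flip S

theorem genusDefect_empty_nonneg (hV : G.vertexSet.Finite) :
    0 ≤ P.genusDefect fun _ => false := by
  have : Finite G.vertexSet := hV
  have hloops : stateLoops P.medial.flip (fun _ => false) ≤ numComponents G fun _ => false :=
    Nat.card_le_card_of_injective _ P.componentOfLoop_empty_injective
  have hcard : Finset.card {_e : G.edgeSet | false = true} = 0 := by simp
  rw [genusDefect, hcard]
  rw [numComponents_empty] at *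
  omega

theorem genusDefect_univ_nonpos (hG : G.IsConnected) [Nonempty G.edgeSet] :
    P.genusDefect (fun _ => true) ≤ 0 := by
  have hcomponents := numComponents_univ_le_one hG
  have hfaces := P.numFaces_le_stateLoops
  have heuler : G.vertexSet.ncard + P.toMap.numFaces = G.edgeSet.ncard + 2 := P.euler
  have hcard : Finset.card {_e : G.edgeSet | true = true} = G.edgeSet.ncard := by
    rw [← Nat.card_coe_set_eq, Nat.card_eq_fintype_card]
    simp
  rw [genusDefect, hcard]
  omega

theorem card_update_true [DecidableEq G.edgeSet] {S : G.edgeSet → Bool} {x : G.edgeSet}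
    (hx : S x = false) : Finset.card {e | Function.update S x true e = true} =
      Finset.card {e | S e = true} + 1 := by
  rw [← Finset.card_insert_of_notMem (a := x) (by simp [hx])]
  congr 1
  ext e
  by_cases he : e = x
  · simp [he]
  · simp [he]

theorem genusDefect_le_update [DecidableEq G.edgeSet] (hV : G.vertexSet.Finite)
    (hG : G.IsConnected) {S : G.edgeSet → Bool} {x : G.edgeSet} (hx : S x = false) :
    P.genusDefect S ≤ P.genusDefect (Function.update S x true) := by
  have : Finite G.vertexSet := hV
  have : Nonempty G.edgeSet := ⟨x⟩
  have hends : G.IsLink x (P.vertexOf (x, false)) (P.vertexOf (x, true)) := P.isLink x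
  rw [genusDefect, genusDefect, card_update_true hx]
  rcases stateLoops_update_true P.medial_flip_involutive P.medial.flip_ne (P.unlinked hV hG) hx
    with hloops | ⟨hloops, t, t', hloop⟩
  · have hcomponents := numComponents_le_update_add_one (S := S) hends
    omega
  · have hcomponents := numComponents_le_update_of_eq (S := S) hends
      (congrArg (P.componentOfLoop S) hloop)
    omega

theorem genusDefect_mono (hV : G.vertexSet.Finite) (hG : G.IsConnected) :
    Monotone P.genusDefect := by
  classical
  have : LocallyFiniteOrder (G.edgeSet → Bool) := Fintype.toLocallyFiniteOrder
  refine (monotone_iff_forall_covBy _).2 fun S S' hcover => ?_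
  obtain ⟨x, b, hb, rfl⟩ := Pi.covBy_iff_exists_right_eq.1 hcover
  obtain ⟨hx, rfl⟩ := Bool.lt_iff.1 hb.lt
  exact P.genusDefect_le_update hV hG hx

theorem stateLoops_eq (hV : G.vertexSet.Finite) (hG : G.IsConnected) [Nonempty G.edgeSet]
    (S : G.edgeSet → Bool) :
    (stateLoops P.medial.flip S : ℤ) =
      2 * numComponents G S + Finset.card {e | S e = true} - G.vertexSet.ncard := by
  have hmono := P.genusDefect_mono hV hG
  have hnonneg := (P.genusDefect_empty_nonneg hV).trans (hmono fun e => (S e).false_le)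
  have hnonpos := (hmono fun e => (S e).le_true).trans (P.genusDefect_univ_nonpos hG)
  rw [genusDefect] at hnonneg hnonpos
  omega

end PlanarEmbedding

end SpanningSubgraphs

section MedialCurves

theorem crossSign_eq_ite {X : Type*} [DecidableEq X] {σ : X → Option Bool} {a b : MedialDart X}
    (hab : a.1.1 = b.1.1) (h : a.2 ≠ b.2) (hσ : σ a.1.1 = none) :
    crossSign σ a b = if a = medialRot b then 1 else -1 := by
  rcases a with ⟨⟨e, s⟩, t⟩
  rcases b with ⟨⟨e', s'⟩, t'⟩
  obtain rfl : e = e' := hab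
  rw [crossSign, if_pos ⟨rfl, hσ⟩]
  cases s <;> cases t <;> cases s' <;> cases t' <;> simp_all [medialRot, endSign]

theorem CombMap.sgn_sq {D : Type*} (M : CombMap D) (b : D) (x : M.Vertex) :
    M.sgn b x ^ 2 = 1 := by
  rw [sgn]
  split_ifs <;> rfl

theorem CombMap.sgn_ne_zero {D : Type*} (M : CombMap D) (b : D) (x : M.Vertex) :
    M.sgn b x ≠ 0 := fun h => by
  simpa [h] using M.sgn_sq b x

namespace PlanarEmbedding

variable {V E : Type*} {G : Graph V E} (P : PlanarEmbedding G)

theorem medial_rot_apply (d : MedialDart G.edgeSet) : P.medial.rot d = medialRot d := by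
  rcases d with ⟨⟨e, s⟩, _ | _⟩ <;> rfl

theorem coe_medial_straight : ⇑P.medial.straight = mate (fun _ => none) ∘ P.medial.flip := by
  funext d
  rw [Function.comp_apply, mate_eq_medialRot_medialRot rfl, ← P.medial_rot_apply,
    ← P.medial_rot_apply]
  rfl

theorem sameCycle_medial_rot (e : G.edgeSet) (s t : Bool) :
    P.medial.rot.SameCycle ((e, true), true) ((e, s), t) := by
  have sameCycle_rot (d : MedialDart G.edgeSet) : P.medial.rot.SameCycle d (medialRot d) := by
    rw [← medial_rot_apply]
    exact Equiv.Perm.sameCycle_apply_right.2 (.refl _ _)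
  have hquarter := sameCycle_rot ((e, true), true)
  have hhalf := hquarter.trans (sameCycle_rot ((e, true), false))
  cases s <;> cases t
  · exact hhalf.trans (sameCycle_rot ((e, false), true))
  · exact hhalf
  · exact hquarter
  · exact .refl _ _

theorem medial_vert_eq_iff [Finite G.edgeSet] {a b : MedialDart G.edgeSet} :
    P.medial.vert a = P.medial.vert b ↔ a.1.1 = b.1.1 := by
  have hsame : P.medial.vert a = P.medial.vert b ↔ P.medial.rot.SameCycle a b := Quotient.eq
  rw [hsame]
  constructor
  · intro h
    obtain ⟨n, rfl⟩ := h.exists_nat_pow_eq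
    clear h hsame
    induction n with
    | zero => rfl
    | succ n ih =>
      rw [pow_succ', Equiv.Perm.mul_apply, medial_rot_apply, medialRot_fst_fst, ← ih]
  · rcases a with ⟨⟨e, s⟩, t⟩
    rcases b with ⟨⟨e', s'⟩, t'⟩
    rintro rfl
    exact (P.sameCycle_medial_rot e s t).symm.trans (P.sameCycle_medial_rot e s' t')

variable {P} {b : MedialDart G.edgeSet}

theorem isTrace_of_isSingleCurve [Finite G.edgeSet] (h : P.medial.IsSingleCurve)
    (b : MedialDart G.edgeSet) :
    IsTrace P.medial.flip (mate fun _ => none)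
      [orbitList P.medial.flip (mate fun _ => none) b] := by
  have hf := P.medial_flip_involutive
  have hm := mate_involutive fun _ : G.edgeSet => none
  have mem_of_sameCycle {d : MedialDart G.edgeSet} (hd : P.medial.straight.SameCycle b d) :
      d ∈ orbitList P.medial.flip (mate fun _ => none) b := by
    obtain ⟨n, rfl⟩ := hd.exists_nat_pow_eq
    rw [mem_orbitList hf hm, ← coe_medial_straight]
    exact ⟨n, by rw [Equiv.Perm.iterate_eq_pow]⟩
  refine ⟨List.forall_mem_singleton.2 (isClosedWalk_orbitList hf hm b), ?_⟩
  rw [List.flatten_singleton]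
  exact isHalf_of_forall hf (orbitList_nodup b)
    (fun d hd => left_notMem_orbitList hf hm P.medial.flip_ne (mate_ne _) hd)
    fun d => (h b d).imp mem_of_sameCycle mem_of_sameCycle

theorem sameCycle_of_isWalk {p z : MedialDart G.edgeSet} {w : List (MedialDart G.edgeSet)}
    (h : IsWalk P.medial.flip (mate fun _ => none) p w z) :
    ∀ a ∈ p :: w, P.medial.straight.SameCycle p a := by
  induction w generalizing p with
  | nil =>
    intro a ha
    rw [List.mem_singleton.1 ha]
  | cons c w ih =>
    obtain rfl : c = P.medial.straight p := by rw [coe_medial_straight]; exact h.1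
    intro a ha
    rcases List.mem_cons.1 ha with rfl | ha
    · exact .refl _ _
    · exact Equiv.Perm.sameCycle_apply_left.1 (ih h.2 a ha)

theorem sameCycle_medial_flip [Finite G.edgeSet] {a c : MedialDart G.edgeSet}
    (h : P.medial.straight.SameCycle (P.medial.flip a) c) :
    P.medial.straight.SameCycle a (P.medial.flip c) := by
  have hf := P.medial_flip_involutive
  obtain ⟨n, rfl⟩ := h.exists_nat_pow_eq
  have hreturn := iterate_comp_left_iterate hf (mate_involutive fun _ => none) n (P.medial.flip a)
  rw [← coe_medial_straight, Equiv.Perm.iterate_eq_pow, hf] at hreturn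
  exact Equiv.Perm.SameCycle.symm ⟨n, by rw [zpow_natCast, hreturn]⟩

theorem isSingleCurve_of_isTrace [Finite G.edgeSet] {w : List (MedialDart G.edgeSet)}
    (h : IsTrace P.medial.flip (mate fun _ => none) [w]) : P.medial.IsSingleCurve := by
  have hf := P.medial_flip_involutive
  have hw : ∀ a ∈ w, ∀ c ∈ w, P.medial.straight.SameCycle a c := by
    have hclosed := h.closed w (.head _)
    cases w with
    | nil => simp
    | cons p w =>
      obtain ⟨z, hz, -⟩ := hclosed
      exact fun a ha c hc => (sameCycle_of_isWalk hz a ha).symm.trans (sameCycle_of_isWalk hz c hc)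
  have hmem := h.half.mem_or hf
  rw [List.flatten_singleton] at hmem
  intro b d
  rcases hmem b with hb | hb <;> rcases hmem d with hd | hd
  · exact .inl (hw b hb d hd)
  · exact .inr (hw b hb _ hd)
  · exact .inr (sameCycle_medial_flip (hw _ hb d hd))
  · exact .inl (hf d ▸ sameCycle_medial_flip (hw _ hb _ hd))

theorem orbitList_medial (b : MedialDart G.edgeSet) :
    orbitList P.medial.flip (mate fun _ => none) b =
      (List.range (Function.minimalPeriod P.medial.straight b)).map (P.medial.curve b) := by
  rw [orbitList, ← coe_medial_straight]
  rfl

end PlanarEmbedding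

end MedialCurves

section Visits

namespace PlanarEmbedding

variable {V E : Type*} {G : Graph V E} {P : PlanarEmbedding G} {b : MedialDart G.edgeSet}
  {x y : P.medial.Vertex} {i k : ℕ}

theorem visits_of_lt (hx : P.medial.firstVisit b x < P.medial.secondVisit b x) :
    P.medial.firstVisit b x ∈ P.medial.visits b x ∧
      P.medial.secondVisit b x ∈ P.medial.visits b x := by
  have hne : (P.medial.visits b x).Nonempty := by
    by_contra hempty
    rw [Set.not_nonempty_iff_eq_empty] at hempty
    simp [CombMap.firstVisit, CombMap.secondVisit, hempty] at hx
  exact ⟨Nat.sInf_mem hne, Nat.sSup_mem hne ⟨_, fun i hi => hi.1.le⟩⟩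

theorem eq_of_secondVisit_eq (hx : P.medial.firstVisit b x < P.medial.secondVisit b x)
    (hy : P.medial.firstVisit b y < P.medial.secondVisit b y)
    (h : P.medial.secondVisit b x = P.medial.secondVisit b y) : x = y := by
  rw [← (visits_of_lt hx).2.2, h, (visits_of_lt hy).2.2]

variable [Finite G.edgeSet]

theorem curve_snd_ne (h : P.medial.IsSingleCurve) (hik : i ≠ k)
    (hi : i < Function.minimalPeriod P.medial.straight b)
    (hk : k < Function.minimalPeriod P.medial.straight b)
    (hv : (P.medial.curve b i).1.1 = (P.medial.curve b k).1.1) :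
    (P.medial.curve b i).2 ≠ (P.medial.curve b k).2 := by
  have curve_mem {j : ℕ} (hj : j < Function.minimalPeriod P.medial.straight b) :
      P.medial.curve b j ∈ [orbitList P.medial.flip (mate fun _ => none) b].flatten := by
    rw [List.flatten_singleton, orbitList_medial]
    exact List.mem_map_of_mem (List.mem_range.2 hj)
  exact (isTrace_of_isSingleCurve h b).snd_ne_of_crossing (curve_mem hi) (curve_mem hk) hv rfl
    fun he => hik ((Function.iterate_eq_iterate_iff_of_lt_minimalPeriod hi hk).1 he)

theorem visits_eq (h : P.medial.IsSingleCurve) (hik : i < k)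
    (hk : k < Function.minimalPeriod P.medial.straight b)
    (hv : (P.medial.curve b i).1.1 = (P.medial.curve b k).1.1) :
    P.medial.visits b (P.medial.vert (P.medial.curve b i)) = {i, k} := by
  ext j
  simp only [CombMap.visits, Set.mem_ofPred_eq, Set.mem_insert_iff, Set.mem_singleton_iff,
    P.medial_vert_eq_iff]
  constructor
  · rintro ⟨hj, hji⟩
    by_contra! hne
    have hsnd_ik := curve_snd_ne h hik.ne (hik.trans hk) hk hv
    have hsnd_ji := curve_snd_ne h hne.1 hj (hik.trans hk) hji
    have hsnd_jk := curve_snd_ne h hne.2 hj hk (hji.trans hv)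
    exact hsnd_ji ((Bool.eq_not.2 hsnd_jk).trans (Bool.eq_not.2 hsnd_ik).symm)
  · rintro (rfl | rfl)
    · exact ⟨hik.trans hk, rfl⟩
    · exact ⟨hk, hv.symm⟩

theorem firstVisit_eq (h : P.medial.IsSingleCurve) (hik : i < k)
    (hk : k < Function.minimalPeriod P.medial.straight b)
    (hv : (P.medial.curve b i).1.1 = (P.medial.curve b k).1.1) :
    P.medial.firstVisit b (P.medial.vert (P.medial.curve b i)) = i := by
  rw [CombMap.firstVisit, visits_eq h hik hk hv, csInf_pair, inf_eq_left.2 hik.le]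

theorem secondVisit_eq (h : P.medial.IsSingleCurve) (hik : i < k)
    (hk : k < Function.minimalPeriod P.medial.straight b)
    (hv : (P.medial.curve b i).1.1 = (P.medial.curve b k).1.1) :
    P.medial.secondVisit b (P.medial.vert (P.medial.curve b i)) = k := by
  rw [CombMap.secondVisit, visits_eq h hik hk hv, csSup_pair, sup_eq_right.2 hik.le]

theorem exists_vertex_of_crossSign_ne_zero (h : P.medial.IsSingleCurve) (hik : i < k)
    (hk : k < Function.minimalPeriod P.medial.straight b)
    (hne : crossSign (fun _ => none) (P.medial.curve b i) (P.medial.curve b k) ≠ 0) :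
    ∃ x, P.medial.firstVisit b x = i ∧ P.medial.secondVisit b x = k := by
  have hv := (crossSign_ne_zero hne).1
  exact ⟨_, firstVisit_eq h hik hk hv, secondVisit_eq h hik hk hv⟩

theorem exists_curve_eq (h : P.medial.IsSingleCurve) (b : MedialDart G.edgeSet) (e : G.edgeSet)
    (t : Bool) : ∃ i < Function.minimalPeriod P.medial.straight b,
      (P.medial.curve b i).1.1 = e ∧ (P.medial.curve b i).2 = t := by
  have hmem := (isTrace_of_isSingleCurve h b).mem_or_apply_mem P.medial_flip_involutive
    ((e, true), t)
  simp only [List.flatten_singleton, orbitList_medial, List.mem_map, List.mem_range] at hmem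
  rcases hmem with ⟨i, hi, hd⟩ | ⟨i, hi, hd⟩ <;> exact ⟨i, hi, by simp [hd, mate, mateOf]⟩

theorem firstVisit_lt_secondVisit (h : P.medial.IsSingleCurve) (b : MedialDart G.edgeSet)
    (x : P.medial.Vertex) : P.medial.firstVisit b x < P.medial.secondVisit b x := by
  obtain ⟨d, rfl⟩ : ∃ d, P.medial.vert d = x := Quotient.exists_rep x
  obtain ⟨i, hi, hid, hi_true⟩ := exists_curve_eq h b d.1.1 true
  obtain ⟨k, hk, hkd, hk_false⟩ := exists_curve_eq h b d.1.1 false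
  rcases lt_trichotomy i k with hik | rfl | hik
  · have hv := hid.trans hkd.symm
    rwa [← P.medial_vert_eq_iff.2 hid, firstVisit_eq h hik hk hv, secondVisit_eq h hik hk hv]
  · simp [hi_true] at hk_false
  · have hv := hkd.trans hid.symm
    rwa [← P.medial_vert_eq_iff.2 hkd, firstVisit_eq h hik hi hv, secondVisit_eq h hik hi hv]

theorem crossSign_visits (h : P.medial.IsSingleCurve) (b : MedialDart G.edgeSet)
    (x : P.medial.Vertex) :
    crossSign (fun _ => none) (P.medial.curve b (P.medial.firstVisit b x))
      (P.medial.curve b (P.medial.secondVisit b x)) = P.medial.sgn b x := by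
  classical
  have hx := firstVisit_lt_secondVisit h b x
  obtain ⟨⟨hfirst, hfirst_vert⟩, hsecond, hsecond_vert⟩ := visits_of_lt hx
  have hv := P.medial_vert_eq_iff.1 (hfirst_vert.trans hsecond_vert.symm)
  rw [crossSign_eq_ite hv (curve_snd_ne h hx.ne hfirst hsecond hv) rfl, CombMap.sgn,
    ← medial_rot_apply]
  congr

theorem defect_eq (h : P.medial.IsSingleCurve) (b : MedialDart G.edgeSet) :
    P.medial.defect b = -2 * interleavedSum (crossSign fun _ => none)
      (orbitList P.medial.flip (mate fun _ => none) b) := by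
  classical
  have : Finite P.medial.Vertex := Quotient.finite _
  have hfinite := {p : P.medial.Vertex × P.medial.Vertex |
    P.medial.Interleaved b p.1 p.2}.toFinite
  have hsum : ∑ᶠ (p : P.medial.Vertex × P.medial.Vertex) (_ : P.medial.Interleaved b p.1 p.2),
      P.medial.sgn b p.1 * P.medial.sgn b p.2 =
      ∑ p ∈ hfinite.toFinset, P.medial.sgn b p.1 * P.medial.sgn b p.2 :=
    finsum_mem_eq_finite_toFinset_sum _ hfinite
  have hlt := firstVisit_lt_secondVisit h b
  rw [CombMap.defect, hsum, interleavedSum, orbitList_medial, quadSum_map_range]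
  simp only [Finset.sum_sigma']
  rw [← Finset.sum_filter_ne_zero (s := Finset.sigma _ _)]
  congr 1
  refine Finset.sum_bij (fun p _ => ⟨P.medial.secondVisit b p.2, P.medial.secondVisit b p.1,
    P.medial.firstVisit b p.2, P.medial.firstVisit b p.1⟩) ?_ ?_ ?_ ?_
  · rintro ⟨x, y⟩ hp
    obtain ⟨hxy, hyx, hyx'⟩ : P.medial.Interleaved b x y := by simpa using hp
    simp only [Finset.mem_filter, Finset.mem_sigma, Finset.mem_range, crossSign_visits h]
    exact ⟨⟨(visits_of_lt (hlt y)).2.1, hyx', hyx, hxy⟩, mul_ne_zero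
      (P.medial.sgn_ne_zero b x) (P.medial.sgn_ne_zero b y)⟩
  · rintro ⟨x, y⟩ - ⟨x', y'⟩ - heq
    simp only [Sigma.mk.injEq, heq_eq_eq] at heq
    exact Prod.ext (eq_of_secondVisit_eq (hlt x) (hlt x') heq.2.1)
      (eq_of_secondVisit_eq (hlt y) (hlt y') heq.1)
  · rintro ⟨l, k, j, i⟩ hm
    simp only [Finset.mem_filter, Finset.mem_sigma, Finset.mem_range] at hm
    obtain ⟨⟨hl, hk, hj, hi⟩, hne⟩ := hm
    obtain ⟨x, rfl, rfl⟩ := exists_vertex_of_crossSign_ne_zero h (hi.trans hj) (hk.trans hl)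
      (left_ne_zero_of_mul hne)
    obtain ⟨y, rfl, rfl⟩ := exists_vertex_of_crossSign_ne_zero h (hj.trans hk) hl
      (right_ne_zero_of_mul hne)
    exact ⟨(x, y), (Set.Finite.mem_toFinset _).2 ⟨hi, hj, hk⟩, rfl⟩
  · simp only [crossSign_visits h, implies_true]

theorem pairSum_crossSign_sq (h : P.medial.IsSingleCurve) (b : MedialDart G.edgeSet) :
    pairSum (fun x y => crossSign (fun _ => none) x y ^ 2)
      (orbitList P.medial.flip (mate fun _ => none) b) = Nat.card G.edgeSet := by
  classical
  have := Fintype.ofFinite G.edgeSet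
  have hlt := firstVisit_lt_secondVisit h b
  rw [orbitList_medial, pairSum_map_range, Nat.card_eq_fintype_card, Fintype.card,
    Finset.card_eq_sum_ones, Nat.cast_sum, Finset.sum_sigma', ← Finset.sum_filter_ne_zero]
  let vertex (e : G.edgeSet) : P.medial.Vertex := P.medial.vert ((e, true), true)
  symm
  refine Finset.sum_bij
    (fun e _ => ⟨P.medial.secondVisit b (vertex e), P.medial.firstVisit b (vertex e)⟩) ?_ ?_ ?_ ?_
  · intro e _
    simp only [Finset.mem_filter, Finset.mem_sigma, Finset.mem_range, crossSign_visits h]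
    exact ⟨⟨(visits_of_lt (hlt _)).2.1, hlt _⟩, by simp [CombMap.sgn_sq]⟩
  · intro e _ e' _ heq
    exact P.medial_vert_eq_iff.1
      (eq_of_secondVisit_eq (hlt _) (hlt _) (congrArg Sigma.fst heq))
  · rintro ⟨k, i⟩ hm
    simp only [Finset.mem_filter, Finset.mem_sigma, Finset.mem_range] at hm
    obtain ⟨⟨hk, hi⟩, hne⟩ := hm
    obtain ⟨x, rfl, rfl⟩ := exists_vertex_of_crossSign_ne_zero h hi hk
      (pow_ne_zero_iff two_ne_zero |>.1 hne)
    obtain ⟨d, rfl⟩ : ∃ d, P.medial.vert d = x := Quotient.exists_rep x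
    have hvertex : vertex d.1.1 = P.medial.vert d := P.medial_vert_eq_iff.2 rfl
    exact ⟨d.1.1, Finset.mem_univ _, by rw [hvertex]⟩
  · simp [crossSign_visits h, CombMap.sgn_sq]

theorem potential_orbitList (h : P.medial.IsSingleCurve) (b : MedialDart G.edgeSet) (n : ℤ) :
    potential (fun _ => none) [orbitList P.medial.flip (mate fun _ => none) b] n =
      -2 * (2 + n + 3 * (Nat.card G.edgeSet - 2 * P.medial.defect b)) := by
  simp only [potential, totalWeight, weight, pairSum_crossSign_sq h, defect_eq h,
    List.map_singleton, List.sum_singleton, List.length_singleton]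
  ring

end PlanarEmbedding

end Visits

section Comparison

variable {V E : Type*} {G : Graph V E} {P Q : PlanarEmbedding G}
  {R R' : List (List (MedialDart G.edgeSet))}

theorem state_sum_eq_state_sum [Finite G.edgeSet] [Nonempty G.edgeSet] (hV : G.vertexSet.Finite)
    (hG : G.IsConnected) (hR : IsTrace P.medial.flip (mate fun _ => none) R)
    (hR' : IsTrace Q.medial.flip (mate fun _ => none) R') :
    R.length = R'.length ∧ potential (fun _ => none) R (Nat.card G.edgeSet) =
      potential (fun _ => none) R' (Nat.card G.edgeSet) := by
  have := Fintype.ofFinite G.edgeSet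
  have hloops (S : G.edgeSet → Bool) :
      stateLoops P.medial.flip S = stateLoops Q.medial.flip S := by
    exact_mod_cast (P.stateLoops_eq hV hG S).trans (Q.stateLoops_eq hV hG S).symm
  have hcard : Nat.card {_e : G.edgeSet // (none : Option Bool) = none} = Nat.card G.edgeSet :=
    Nat.card_congr (Equiv.subtypeUnivEquiv fun _ => rfl)
  obtain ⟨hpow, hpotential⟩ := hR.state_sum P.medial_flip_involutive (P.unlinked hV hG) hcard
  obtain ⟨hpow', hpotential'⟩ := hR'.state_sum Q.medial_flip_involutive (Q.unlinked hV hG) hcard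
  simp only [hloops] at hpow hpotential
  have hpow_eq := congrArg Int.natAbs (hpow.trans hpow'.symm)
  simp only [Int.natAbs_pow] at hpow_eq
  exact ⟨Nat.pow_right_injective le_rfl hpow_eq, hpotential.trans hpotential'.symm⟩

end Comparison

theorem mainTheorem3 {V E : Type*} (G : Graph V E) (hV : G.vertexSet.Finite)
    (hE : G.edgeSet.Finite) (hconn : G.IsConnected) (P Q : PlanarEmbedding G)
    (hP : P.Unicursal) :
    Q.Unicursal ∧ ∀ b c, P.medial.defect b = Q.medial.defect c := by
  rcases isEmpty_or_nonempty G.edgeSet with hempty | hnonempty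
  · exact ⟨fun b => isEmptyElim b.1.1, fun b => isEmptyElim b.1.1⟩
  have : Finite G.edgeSet := hE
  have htraceP := PlanarEmbedding.isTrace_of_isSingleCurve hP
  have hQ : Q.Unicursal := by
    have e : G.edgeSet := hnonempty.some
    obtain ⟨R, hR⟩ := exists_isTrace Q.medial_flip_involutive (mate_involutive fun _ => none)
      Q.medial.flip_ne (mate_ne _)
    have hlength := (state_sum_eq_state_sum hV hconn (htraceP ((e, true), true)) hR).1
    obtain ⟨w, rfl⟩ := List.length_eq_one_iff.1 hlength.symm
    exact PlanarEmbedding.isSingleCurve_of_isTrace hR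
  refine ⟨hQ, fun b c => ?_⟩
  have hpotential := (state_sum_eq_state_sum hV hconn (htraceP b)
    (PlanarEmbedding.isTrace_of_isSingleCurve hQ c)).2
  rw [PlanarEmbedding.potential_orbitList hP, PlanarEmbedding.potential_orbitList hQ] at hpotential
  linarith
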